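/- **Setting.** There are $K$ arms with means $\mu_i\in[0,\bar\mu]$ and $M$ sources; source $j$ has a mean-zero noise law $\mathcal D(j)$ supported in $[-\bar\eta,\bar\eta]$ with standard deviation $\sigma_j$ and fourth central moment $\kappa_j$. In each round $t=1,\dots,T$ the learner picks an arm $i_t$ and a source $j_t$ from the past and observes $X_t=\mu_{i_t}+\varepsilon_t$, where, given the past, $\varepsilon_t\sim\mathcal D(j_t)$. Put $\mu^*=\max_i\mu_i$, $\Delta_i=\mu^*-\mu_i$, $\sigma^*=\min_j\sigma_j$ and $\mathrm{Reg}_T=\sum_{t\le T}(\mu^*-\mu_{i_t})$. **Algorithm SOAR.** Inputs: $\delta\in(0,1)$, $c^*,\nu>0$, integers $\tau_p,\alpha,\beta$, and the value of $\kappa_j$ for those sources for which it is known. (1) *Preprocessing.* Query every source $\tau_p$ times on a fixed arm $i_0$. Let $\hat\mu$ be the mean of the $M\tau_p$ rewards, $\hat\sigma^2_{j,\mathrm{pre}}$ the mean of $(X_s-\hat\mu)^2$ over the queries of $j$, $w=8\bar\eta^2\sqrt{\log(12M/\delta')/\tau_p}$ with $\delta'=\delta/3$, $\mathrm{UCB}^{\mathrm{pre}}(j)=\hat\sigma^2_{j,\mathrm{pre}}+w$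 and $\mathrm{LCB}^{\mathrm{pre}}(j)=\max\{\hat\sigma^2_{j,\mathrm{pre}}-w,0\}$. The set $S_{\mathcal G}$ of surviving sources consists of the $j$ with $\mathrm{LCB}^{\mathrm{pre}}(j)\le\min_k\mathrm{UCB}^{\mathrm{pre}}(k)$. (2) *Initial exploration.* Choose $\bar j\in S_{\mathcal G}$ with $\mathrm{LCB}^{\mathrm{pre}}(\bar j)\ge {c^*}^2/2$ (any $\bar j\in S_{\mathcal G}$ if there is none) and pull each arm $\alpha$ times with source $\bar j$; then query each $j\in S_{\mathcal G}$ $\beta$ times on a fixed arm. (3) *Adaptive phase.* From now on all statistics use the rounds after preprocessing. Let $n_i(t),m_j(t),n_{ij}(t)$ be the numbers of these rounds up to $t$ with arm $i$, with source $j$, with the pair $(i,j)$; let $\hat\mu_i(t),\hat\mu_{ij}(t)$ be the corresponding empirical means, $\hat\sigma_j^2(t)=\frac{1}{m_j(t)-K}\sum_i\sum_{s:(i_s,j_s)=(i,j)}(X_s-\hat\mu_{ij}(t))^2$, and $Q_j(t)=\max\{\kappa_j,\nu\}$ if $\kappa_j$ is known, $Q_j(t)=\max\{\bar\eta^2\hat\sigma_j^2(t),\nu\}$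 otherwise. In every remaining round $t+1$ play $i_{t+1}\in\arg\max_i\mathrm{UCB}_t(i)$ and $j_{t+1}\in\arg\min_{j\in S_{\mathcal G}}\mathrm{LCB}_t(j)$ (ties broken arbitrarily), where $$\mathrm{UCB}_t(i)=\hat\mu_i(t)+\frac{2\sqrt{2\log(3KT/\delta)\sum_j n_{ij}(t)\hat\sigma_j^2(t)}}{n_i(t)},\qquad \mathrm{LCB}_t(j)=\hat\sigma_j^2(t)-2\sqrt{\frac{Q_j(t)\log(3MT/\delta)}{m_j(t)-K}} .$$ **Theorem.** Let $R\ge1$. There are $C>0$ and $q\in\mathbb N$ depending only on $R$ such that the following holds for all $K,M,T\ge1$, all $\delta\in(0,1)$, all $c^*,\nu,\gamma>0$ and every instance as above for which $c^*$ is of the order of the $\sigma_j$ in the sense that $c^*\le R\,\sigma_j$ for all $j$. Run SOAR with an integer budget $\tau_p\ge\max\{1,\tau_{\min}\}$, $\tau_{\min}=\frac{1024\,\bar\eta^4\log(12M/\delta)}{{c^*}^4}$, and $$\alpha=\Big\lceil\frac{\bar\eta^2\log(3KT/\delta)}{{c^*}^2}\Big\rceil,\qquad \beta=\Big\lceil 2K+\frac{4\bar\eta^4\log(3MT/\delta)}{\nu}+\frac{16\bar\eta^4\log(3MT/\delta)}{{c^*}^4}\Big\rceil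 .$$ Put $$E=\frac{M\bar\eta^4\bar\mu}{{c^*}^4}+\frac{K\bar\eta^2\bar\mu}{{c^*}^2}+KM\bar\mu+\frac{M\bar\eta^4\bar\mu}{\nu}+\frac{M\bar\eta^4\bar\mu}{{c^*}^4}+M\bar\mu\,(\tau_p-\tau_{\min}),\qquad \Lambda=C\Big(\log\frac{3KMT}{\delta}\Big)^{q}.$$ Then, with probability at least $1-\delta$: if some $j\in S_{\mathcal G}$ has $\sigma_j^2\ge{c^*}^2$, then both $$\mathrm{Reg}_T\le\Lambda\Bigg(E+\sqrt{K^2M{c^*}^2+\sum_{j\in S_{\mathcal G}:\,\sigma_j-\sigma^*>\gamma}\frac{K\,Q_j(T)}{(\gamma+2\sigma^*)^2}}+\sum_{i:\,\Delta_i>0}\frac{(\sigma^*+\gamma)^2}{\Delta_i}\Bigg)$$ and $$\mathrm{Reg}_T\le\Lambda\Big(E+(\sigma^*+c^*)\sqrt{KT}\Big).$$ -/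

import Mathlib

open MeasureTheory ProbabilityTheory

noncomputable section

/-- One round of interaction: the selected arm, the selected source, the observed reward. -/
abbrev Round (K M : ℕ) : Type := Fin K × Fin M × ℝ

namespace Soar

/-! ### The multi-source bandit model -/

/-- Standard deviation of a noise law. -/
def sd (D : Measure ℝ) : ℝ := Real.sqrt (variance id D)

/-- `σ*`, the smallest standard deviation among the sources. -/
def sdMin {M : ℕ} (D : Fin M → Measure ℝ) : ℝ := ⨅ j, sd (D j)

/-- `Δ_i = μ* - μ_i`, the suboptimality gap of arm `i`. -/
def gap {K : ℕ} (mu : Fin K → ℝ) (i : Fin K) : ℝ := (⨆ k, mu k) - mu i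

/-- An admissible family of noise laws: mean-zero probability laws supported in `[-η, η]`. -/
structure NoiseLaws {M : ℕ} (D : Fin M → Measure ℝ) (eta : ℝ) : Prop where
  prob : ∀ j, IsProbabilityMeasure (D j)
  bounded : ∀ j, ∀ᵐ x ∂(D j), x ∈ Set.Icc (-eta) eta
  centered : ∀ j, ∫ x, x ∂(D j) = 0

/-- The interaction of a (possibly randomized) learner with the bandit. Rounds are numbered from
`0`; `ℱ t` is the information available before round `t`. The pair chosen in round `t` depends on
that information only, and given `ℱ t` the noise `X t - mu (arm t)` has law `D (src t)`. -/
structure Interaction {K M : ℕ} {Ω : Type*} [mΩ : MeasurableSpace Ω] (P : Measure Ω)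
    (ℱ : Filtration ℕ mΩ) (mu : Fin K → ℝ) (D : Fin M → Measure ℝ)
    (arm : ℕ → Ω → Fin K) (src : ℕ → Ω → Fin M) (X : ℕ → Ω → ℝ) : Prop where
  arm_meas : ∀ t, Measurable[ℱ t] (arm t)
  src_meas : ∀ t, Measurable[ℱ t] (src t)
  reward_meas : ∀ t, Measurable[ℱ (t + 1)] (X t)
  noise_law : ∀ (t : ℕ) (j : Fin M) (A : Set Ω) (B : Set ℝ),
    MeasurableSet[ℱ t] A → MeasurableSet B →
      P {ω | ω ∈ A ∧ src t ω = j ∧ X t ω - mu (arm t ω) ∈ B}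
        = P {ω | ω ∈ A ∧ src t ω = j} * D j B

/-- The regret over the first `T` rounds. -/
def regret {K : ℕ} {Ω : Type*} (mu : Fin K → ℝ) (arm : ℕ → Ω → Fin K) (T : ℕ) (ω : Ω) : ℝ :=
  ∑ t ∈ Finset.range T, gap mu (arm t ω)

/-! ### Statistics of the rounds `a, a + 1, …, t - 1` of a trajectory `x` -/

section Statistics

variable {K M : ℕ} (x : ℕ → Round K M) (a t : ℕ)

/-- The rounds in which arm `i` was pulled. -/
def armRounds (i : Fin K) : Finset ℕ := {s ∈ Finset.Ico a t | (x s).1 = i}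

/-- The rounds in which source `j` was queried. -/
def srcRounds (j : Fin M) : Finset ℕ := {s ∈ Finset.Ico a t | (x s).2.1 = j}

/-- The rounds in which arm `i` was pulled with source `j`. -/
def pairRounds (i : Fin K) (j : Fin M) : Finset ℕ :=
  {s ∈ Finset.Ico a t | (x s).1 = i ∧ (x s).2.1 = j}

/-- Empirical mean reward of arm `i`. -/
def armMean (i : Fin K) : ℝ := (∑ s ∈ armRounds x a t i, (x s).2.2) / (armRounds x a t i).card

/-- Empirical mean reward of arm `i` observed through source `j`. -/
def pairMean (i : Fin K) (j : Fin M) : ℝ :=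
  (∑ s ∈ pairRounds x a t i j, (x s).2.2) / (pairRounds x a t i j).card

/-- Pooled variance estimate of source `j`. -/
def pooledVar (j : Fin M) : ℝ :=
  (∑ i, ∑ s ∈ pairRounds x a t i j, ((x s).2.2 - pairMean x a t i j) ^ 2)
    / (((srcRounds x a t j).card : ℝ) - K)

end Statistics

/-! ### The algorithm -/

/-- The inputs of the algorithm: horizon `T`, preprocessing budget `tau`, confidence `delta`,
noise bound `eta`, parameters `c` (that is, `c*`) and `nu`, and the fourth central moments of those
sources for which it is known. -/
structure Params (M : ℕ) where
  T : ℕ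
  tau : ℕ
  delta : ℝ
  eta : ℝ
  c : ℝ
  nu : ℝ
  kappa : Fin M → Option ℝ

namespace Params

variable {K M : ℕ} (p : Params M) (x : ℕ → Round K M)

/-- Number of preprocessing rounds. -/
def prep : ℕ := M * p.tau

/-- Empirical variance of source `j` in the preprocessing phase. -/
def preVar (j : Fin M) : ℝ :=
  (∑ s ∈ srcRounds x 0 p.prep j, ((x s).2.2 - armMean x 0 p.prep (x s).1) ^ 2)
    / (srcRounds x 0 p.prep j).card

/-- Confidence width of the preprocessing phase, run at confidence level `d`. -/
def preWidth (d : ℝ) : ℝ := 8 * p.eta ^ 2 * Real.sqrt (Real.log (12 * M / d) / p.tau)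

def preUCB (d : ℝ) (j : Fin M) : ℝ := p.preVar x j + p.preWidth d

def preLCB (d : ℝ) (j : Fin M) : ℝ := max (p.preVar x j - p.preWidth d) 0

open Classical in
/-- The sources kept by the preprocessing phase, which is called at confidence level `δ / 3`:
a source is dropped when its lower bound exceeds the smallest upper bound. -/
def surviving : Finset (Fin M) :=
  {j | ∀ k, p.preLCB x (p.delta / 3) j ≤ p.preUCB x (p.delta / 3) k}

/-- `log (3 K T / δ)`. -/
def logArm (K : ℕ) : ℝ := Real.log (3 * K * p.T / p.delta)

/-- `log (3 M T / δ)`. -/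
def logSrc : ℝ := Real.log (3 * M * p.T / p.delta)

/-- Initial number of pulls of each arm. -/
def alpha (K : ℕ) : ℕ := ⌈p.eta ^ 2 * p.logArm K / p.c ^ 2⌉₊

/-- Initial number of queries of each surviving source. -/
def beta (K : ℕ) : ℕ :=
  ⌈2 * K + 4 * p.eta ^ 4 * p.logSrc / p.nu + 16 * p.eta ^ 4 * p.logSrc / p.c ^ 4⌉₊

/-- `Q_j(t)`. The estimators of the second stage use the observations made after preprocessing. -/
def Q (t : ℕ) (j : Fin M) : ℝ :=
  match p.kappa j with
  | some k => max k p.nu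
  | none => max (p.eta ^ 2 * pooledVar x p.prep t j) p.nu

/-- Lower confidence bound on the variance of source `j` before round `t`. -/
def LCB (t : ℕ) (j : Fin M) : ℝ :=
  pooledVar x p.prep t j
    - 2 * Real.sqrt (p.Q x t j * p.logSrc / (((srcRounds x p.prep t j).card : ℝ) - K))

/-- Upper confidence bound on the mean of arm `i` before round `t`. -/
def UCB (t : ℕ) (i : Fin K) : ℝ :=
  armMean x p.prep t i
    + 2 * Real.sqrt (2 * p.logArm K *
        ∑ j, ((pairRounds x p.prep t i j).card : ℝ) * pooledVar x p.prep t j)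
      / (armRounds x p.prep t i).card

/-- First round of the second part of the initial exploration. -/
def start₂ (K : ℕ) : ℕ := p.prep + K * p.alpha K

/-- First round of the adaptive phase. -/
def start₃ : ℕ := p.start₂ K + (p.surviving x).card * p.beta K

/-- The trajectory `x` is, during its first `T` rounds, a run of SOAR, with the arm `i₀` used for
preprocessing and the arm `i₁` used for the initial exploration of the sources. Ties, and the
choice of the source `jbar`, are resolved arbitrarily. -/
structure IsRun (i₀ i₁ : Fin K) : Prop where
  /-- Every source is queried `tau` times on arm `i₀`. -/
  preprocess : ∀ t < p.T, t < p.prep → (x t).1 = i₀ ∧ ((x t).2.1 : ℕ) = t / p.tau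
  /-- Every arm is pulled `alpha` times with a surviving source whose preprocessing lower bound is
  at least `c² / 2`, if there is one. -/
  explore_arms : ∃ jbar ∈ p.surviving x,
    ((∃ j ∈ p.surviving x, p.c ^ 2 / 2 ≤ p.preLCB x (p.delta / 3) j) →
      p.c ^ 2 / 2 ≤ p.preLCB x (p.delta / 3) jbar) ∧
    ∀ t < p.T, p.prep ≤ t → t < p.start₂ K →
      ((x t).1 : ℕ) = (t - p.prep) / p.alpha K ∧ (x t).2.1 = jbar
  /-- The surviving sources are queried `beta` times each on arm `i₁`, in increasing order. -/
  explore_sources : ∀ t < p.T, p.start₂ K ≤ t → t < p.start₃ x →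
    (x t).1 = i₁ ∧ (x t).2.1 ∈ p.surviving x ∧
      {k ∈ p.surviving x | k < (x t).2.1}.card = (t - p.start₂ K) / p.beta K
  /-- Afterwards the arm maximizes the upper bound on the mean and the source minimizes the lower
  bound on the variance. -/
  adaptive : ∀ t < p.T, p.start₃ x ≤ t →
    (∀ i, p.UCB x t i ≤ p.UCB x t (x t).1) ∧
    (x t).2.1 ∈ p.surviving x ∧ ∀ j ∈ p.surviving x, p.LCB x t (x t).2.1 ≤ p.LCB x t j

/-- The smallest admissible preprocessing budget, as a real number. -/
def minBudget : ℝ := 1024 * p.eta ^ 4 * Real.log (12 * M / p.delta) / p.c ^ 4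

/-! ### The terms of the regret bounds -/

/-- Preprocessing and exploration terms. The last summand is the cost of a preprocessing budget
above the smallest admissible one. -/
def exploration (K : ℕ) (muBar : ℝ) : ℝ :=
  M * p.eta ^ 4 * muBar / p.c ^ 4 + K * p.eta ^ 2 * muBar / p.c ^ 2 + K * M * muBar
    + M * p.eta ^ 4 * muBar / p.nu + M * p.eta ^ 4 * muBar / p.c ^ 4
    + M * muBar * (p.tau - p.minBudget)

open Classical in
/-- `√(K² M c*² + ∑_{j : σ_j - σ* > γ} K Q_j(T) / (γ + 2 σ*)²)`, over the surviving sources. -/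
def separation (D : Fin M → Measure ℝ) (gamma : ℝ) : ℝ :=
  Real.sqrt ((K : ℝ) ^ 2 * M * p.c ^ 2
    + ∑ j ∈ p.surviving x with gamma < sd (D j) - sdMin D,
        K * p.Q x p.T j / (gamma + 2 * sdMin D) ^ 2)

end Params

open Classical in
/-- `∑ (σ* + γ)² / Δ_i` over the suboptimal arms. -/
def gapSum {K M : ℕ} (mu : Fin K → ℝ) (D : Fin M → Measure ℝ) (gamma : ℝ) : ℝ :=
  ∑ i with 0 < gap mu i, (sdMin D + gamma) ^ 2 / gap mu i

end Soar

end

/-! The analysis rests on one fact: with at least one survivor satisfying `σ_j ≥ c`, all surviving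
sources have comparable variances. The preprocessing budget makes every preliminary variance
estimate and confidence width a small multiple of `c²`, so survivors satisfy `σ_j² ≤ σ*² + 0.65 c²`
(`Regime.sd_sq_le`). Hence `σ*² ≥ 0.35 c²` and `σ_j² ≤ (20/7) σ*²` for every survivor. Which
survivor is queried later then costs only a constant factor, and the regret analysis is that of a
UCB algorithm with noise level `σ*`. In the first bound the separation term enters only through its
nonnegativity.

All deviation bounds come from one exponential supermartingale (`Interaction.lintegral_exp_sum_le`),
whose increments are quadratic in the current noise with predictable coefficients. Depending on the
coefficients it yields Hoeffding bounds for preprocessing, Bernstein bounds for arm means, and both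
tails of the pooled variance. The lower tail is the delicate one: Welford's recursion writes the
pooled sum of squares as weighted squares around predictable centers, and `exists_exp_neg_sq_le`
gives a decay that does not depend on the center. `Interaction.measure_not_good_le` collects the
failures, which add up to exactly `δ`.

On the good event the pooled variances of survivors lie between `0.36 σ_j²` and `5 σ_j²`. The
Bernstein tilt for an arm is fixed by its number of pulls, which is possible because its accumulated
variance is known within the factor `20/7`. This gives optimism for a best arm
(`Regime.le_UCB_best`). For an arm pulled in the adaptive phase, `n Δ ≤ 18 √(n L) σ*`
(`Regime.card_mul_gap_le`), hence `n Δ² ≤ 324 L σ*²`, with `L = log (3KT/δ)`.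

Summing over arms gives the gap-dependent bound; Cauchy–Schwarz over rounds gives the `√(KT)` bound.
Earlier rounds cost at most `muBar` each and are paid for by the exploration term (`start₃_mul_le`).
-/

namespace Soar

/-! ### Exponential supermartingales along the interaction. -/

section Engine

variable {K M : ℕ} {Ω : Type*} [mΩ : MeasurableSpace Ω] {P : Measure Ω}
  {ℱ : Filtration ℕ mΩ} {mu : Fin K → ℝ} {D : Fin M → Measure ℝ}
  {arm : ℕ → Ω → Fin K} {src : ℕ → Ω → Fin M} {X : ℕ → Ω → ℝ}

/-- The noise of round `t`. -/
def noise (mu : Fin K → ℝ) (arm : ℕ → Ω → Fin K) (X : ℕ → Ω → ℝ) (t : ℕ) (ω : Ω) : ℝ :=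
  X t ω - mu (arm t ω)

theorem Interaction.measurable_noise_succ (h : Interaction P ℱ mu D arm src X) (t : ℕ) :
    Measurable[ℱ (t + 1)] (noise mu arm X t) :=
  (h.reward_meas t).sub
    ((measurable_of_finite mu).comp ((h.arm_meas t).mono (ℱ.mono t.le_succ) le_rfl))

theorem Interaction.measurable_noise (h : Interaction P ℱ mu D arm src X) (t : ℕ) :
    Measurable (noise mu arm X t) :=
  (h.measurable_noise_succ t).mono (ℱ.le _) le_rfl

theorem Interaction.measurableSet_src (h : Interaction P ℱ mu D arm src X) (t : ℕ) (j : Fin M) :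
    MeasurableSet {ω | src t ω = j} :=
  ((h.src_meas t).mono (ℱ.le _) le_rfl) (measurableSet_singleton j)

/-- `noise_law` is the product formula on rectangles, which determine a product measure. Restricting
to one value of the source fixes the noise law and avoids conditional expectations. -/
theorem Interaction.map_eq_prod [IsProbabilityMeasure P] [∀ j, IsProbabilityMeasure (D j)]
    (h : Interaction P ℱ mu D arm src X) (t : ℕ) (j : Fin M) {α : Type*} [MeasurableSpace α]
    {Y : Ω → α} (hY : Measurable[ℱ t] Y) :
    (P.restrict {ω | src t ω = j}).map (fun ω => (Y ω, noise mu arm X t ω))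
      = ((P.restrict {ω | src t ω = j}).map Y).prod (D j) := by
  have hY' : Measurable Y := hY.mono (ℱ.le _) le_rfl
  have hS := h.measurableSet_src t j
  symm
  refine Measure.prod_eq fun A B hA hB => ?_
  rw [Measure.map_apply (hY'.prodMk (h.measurable_noise t)) (hA.prod hB),
    Measure.map_apply hY' hA, Measure.restrict_apply (hY' hA),
    Measure.restrict_apply ((hY'.prodMk (h.measurable_noise t)) (hA.prod hB))]
  have := h.noise_law t j (Y ⁻¹' A) B (hY hA) hB
  have e1 : ((fun ω => (Y ω, noise mu arm X t ω)) ⁻¹' A ×ˢ B) ∩ {ω | src t ω = j}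
      = {ω | ω ∈ Y ⁻¹' A ∧ src t ω = j ∧ X t ω - mu (arm t ω) ∈ B} := by
    ext ω
    simp only [Set.mem_inter_iff, Set.mem_preimage, Set.mem_prod, Set.mem_ofPred_eq, noise]
    tauto
  rw [e1, this]
  rfl

/-- Freezing lemma: the noise of round `t` is integrated out with the past held fixed, separately on
each set where the source is constant. -/
theorem Interaction.lintegral_le [IsProbabilityMeasure P] [∀ j, IsProbabilityMeasure (D j)]
    (h : Interaction P ℱ mu D arm src X) (t : ℕ) {α : Type*} [MeasurableSpace α]
    {Y : Ω → α} (hY : Measurable[ℱ t] Y) {G : α → ℝ → ENNReal}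
    (hG : Measurable (Function.uncurry G)) {H : Ω → ENNReal}
    (hH : ∀ ω, ∫⁻ e, G (Y ω) e ∂(D (src t ω)) ≤ H ω) :
    ∫⁻ ω, G (Y ω) (noise mu arm X t ω) ∂P ≤ ∫⁻ ω, H ω ∂P := by
  have hY' : Measurable Y := hY.mono (ℱ.le _) le_rfl
  have hU : (⋃ j ∈ (Finset.univ : Finset (Fin M)), {ω | src t ω = j}) = Set.univ := by
    ext ω; simp
  have hd : Set.PairwiseDisjoint (↑(Finset.univ : Finset (Fin M))) fun j => {ω | src t ω = j} := by
    intro i _ j _ hij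
    rw [Function.onFun, Set.disjoint_left]
    intro ω hi hj
    exact hij (hi.symm.trans hj)
  have key : ∀ f : Ω → ENNReal,
      ∫⁻ ω, f ω ∂P = ∑ j, ∫⁻ ω in {ω | src t ω = j}, f ω ∂P := by
    intro f
    rw [← lintegral_biUnion_finset hd (fun j _ => h.measurableSet_src t j), hU,
      Measure.restrict_univ]
  rw [key, key]
  refine Finset.sum_le_sum fun j _ => ?_
  have e1 : ∫⁻ ω in {ω | src t ω = j}, G (Y ω) (noise mu arm X t ω) ∂P
      = ∫⁻ ω in {ω | src t ω = j}, ∫⁻ e, G (Y ω) e ∂(D j) ∂P := by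
    have := lintegral_map (μ := P.restrict {ω | src t ω = j}) hG
      (hY'.prodMk (h.measurable_noise t))
    rw [h.map_eq_prod t j hY, lintegral_prod _ hG.aemeasurable,
      lintegral_map hG.lintegral_prod_right' hY'] at this
    exact this.symm
  rw [e1]
  refine setLIntegral_mono' (h.measurableSet_src t j) fun ω hω => ?_
  have := hH ω
  rwa [show src t ω = j from hω] at this

/-- Each conditional factor has mean at most one, so the exponential is a supermartingale started at
one. Quadratic increments cover both linear and variance deviations. -/
theorem Interaction.lintegral_exp_sum_le [IsProbabilityMeasure P]
    [∀ j, IsProbabilityMeasure (D j)] (h : Interaction P ℱ mu D arm src X)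
    {k₀ k₁ k₂ : ℕ → Ω → ℝ} (h₀ : ∀ s, Measurable[ℱ s] (k₀ s)) (h₁ : ∀ s, Measurable[ℱ s] (k₁ s))
    (h₂ : ∀ s, Measurable[ℱ s] (k₂ s))
    (H : ∀ s ω, ∫⁻ e, ENNReal.ofReal (Real.exp (k₀ s ω + k₁ s ω * e + k₂ s ω * e ^ 2))
      ∂(D (src s ω)) ≤ 1) (t : ℕ) :
    ∫⁻ ω, ENNReal.ofReal (Real.exp (∑ s ∈ Finset.range t, (k₀ s ω + k₁ s ω * noise mu arm X s ω
      + k₂ s ω * noise mu arm X s ω ^ 2))) ∂P ≤ 1 := by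
  induction t with
  | zero => simp
  | succ t ih =>
    have hZ : Measurable[ℱ t] fun ω => ∑ s ∈ Finset.range t, (k₀ s ω + k₁ s ω * noise mu arm X s ω
        + k₂ s ω * noise mu arm X s ω ^ 2) := by
      refine Finset.measurable_sum _ fun s hs => ?_
      have hst : s < t := Finset.mem_range.1 hs
      have hn := (h.measurable_noise_succ s).mono (ℱ.mono hst) le_rfl
      have h0 := (h₀ s).mono (ℱ.mono hst.le) le_rfl
      have h1 := (h₁ s).mono (ℱ.mono hst.le) le_rfl
      have h2 := (h₂ s).mono (ℱ.mono hst.le) le_rfl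
      exact (h0.add (h1.mul hn)).add (h2.mul (hn.pow_const 2))
    refine le_trans ?_ ih
    simp_rw [Finset.sum_range_succ]
    -- The accumulated sum and the three coefficients of round `t` form the vector that is frozen.
    refine h.lintegral_le t (α := ℝ × ℝ × ℝ × ℝ)
      (Y := fun ω => (∑ s ∈ Finset.range t, (k₀ s ω + k₁ s ω * noise mu arm X s ω
        + k₂ s ω * noise mu arm X s ω ^ 2), k₀ t ω, k₁ t ω, k₂ t ω))
      (hZ.prodMk ((h₀ t).prodMk ((h₁ t).prodMk (h₂ t))))
      (G := fun y e => ENNReal.ofReal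
        (Real.exp (y.1 + (y.2.1 + y.2.2.1 * e + y.2.2.2 * e ^ 2)))) ?_ ?_
    · unfold Function.uncurry
      fun_prop
    · intro ω
      simp only [Real.exp_add (∑ s ∈ _, _), ENNReal.ofReal_mul (Real.exp_pos _).le]
      rw [lintegral_const_mul _ (by fun_prop)]
      exact mul_le_of_le_one_right' (H t ω)

theorem Interaction.measure_le_exp_neg [IsProbabilityMeasure P]
    [∀ j, IsProbabilityMeasure (D j)] (h : Interaction P ℱ mu D arm src X)
    {k₀ k₁ k₂ : ℕ → Ω → ℝ} (h₀ : ∀ s, Measurable[ℱ s] (k₀ s)) (h₁ : ∀ s, Measurable[ℱ s] (k₁ s))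
    (h₂ : ∀ s, Measurable[ℱ s] (k₂ s))
    (H : ∀ s ω, ∫⁻ e, ENNReal.ofReal (Real.exp (k₀ s ω + k₁ s ω * e + k₂ s ω * e ^ 2))
      ∂(D (src s ω)) ≤ 1) (t : ℕ) (x : ℝ) :
    P {ω | x < ∑ s ∈ Finset.range t, (k₀ s ω + k₁ s ω * noise mu arm X s ω
      + k₂ s ω * noise mu arm X s ω ^ 2)} ≤ ENNReal.ofReal (Real.exp (-x)) := by
  have hn := h.measurable_noise
  have hm : Measurable fun ω => ENNReal.ofReal (Real.exp (∑ s ∈ Finset.range t,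
      (k₀ s ω + k₁ s ω * noise mu arm X s ω + k₂ s ω * noise mu arm X s ω ^ 2))) := by
    refine (Real.measurable_exp.comp (Finset.measurable_sum _ fun s _ => ?_)).ennreal_ofReal
    have h0 := (h₀ s).mono (ℱ.le s) le_rfl
    have h1 := (h₁ s).mono (ℱ.le s) le_rfl
    have h2 := (h₂ s).mono (ℱ.le s) le_rfl
    exact (h0.add (h1.mul (hn s))).add (h2.mul ((hn s).pow_const 2))
  have hx : ENNReal.ofReal (Real.exp x) ≠ 0 := by simp [Real.exp_pos]
  calc _ ≤ P {ω | ENNReal.ofReal (Real.exp x) ≤ ENNReal.ofReal (Real.exp (∑ s ∈ Finset.range t,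
      (k₀ s ω + k₁ s ω * noise mu arm X s ω + k₂ s ω * noise mu arm X s ω ^ 2)))} :=
        measure_mono fun ω hω => ENNReal.ofReal_le_ofReal (Real.exp_le_exp.2 (le_of_lt hω))
    _ ≤ _ := meas_ge_le_lintegral_div hm.aemeasurable hx ENNReal.ofReal_ne_top
    _ ≤ 1 / ENNReal.ofReal (Real.exp x) := by
        gcongr; exact h.lintegral_exp_sum_le h₀ h₁ h₂ H t
    _ = _ := by rw [Real.exp_neg, one_div, ENNReal.ofReal_inv_of_pos (Real.exp_pos x)]

end Engine

/-! ### Exponential moments of a bounded centered variable. -/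

section Moments

/-- A centered probability law on `[-η, η]`. -/
structure CenteredLaw (ν : Measure ℝ) (eta : ℝ) : Prop where
  prob : IsProbabilityMeasure ν
  bounded : ∀ᵐ x ∂ν, x ∈ Set.Icc (-eta) eta
  centered : ∫ x, x ∂ν = 0

theorem NoiseLaws.law {M : ℕ} {D : Fin M → Measure ℝ} {eta : ℝ} (h : NoiseLaws D eta) (j : Fin M) :
    CenteredLaw (D j) eta := ⟨h.prob j, h.bounded j, h.centered j⟩

variable {ν : Measure ℝ} {eta : ℝ}

namespace CenteredLaw

theorem eta_nonneg (h : CenteredLaw ν eta) : 0 ≤ eta := by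
  have := h.prob
  obtain ⟨x, hx⟩ := h.bounded.exists
  linarith [hx.1, hx.2]

theorem integrable_id (h : CenteredLaw ν eta) : Integrable (fun x => x) ν := by
  have := h.prob
  exact Integrable.of_mem_Icc _ _ aemeasurable_id h.bounded

theorem sq_mem (h : CenteredLaw ν eta) : ∀ᵐ x ∂ν, x ^ 2 ∈ Set.Icc 0 (eta ^ 2) := by
  filter_upwards [h.bounded] with x hx
  exact ⟨sq_nonneg x, sq_le_sq' hx.1 hx.2⟩

theorem integrable_sq (h : CenteredLaw ν eta) : Integrable (fun x => x ^ 2) ν := by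
  have := h.prob
  exact Integrable.of_mem_Icc _ _ (by fun_prop) h.sq_mem

theorem integral_sq (h : CenteredLaw ν eta) : ∫ x, x ^ 2 ∂ν = sd ν ^ 2 := by
  have := h.prob
  rw [sd, Real.sq_sqrt (variance_nonneg _ _), variance_of_integral_eq_zero aemeasurable_id]
  · rfl
  · exact h.centered

theorem sd_le (h : CenteredLaw ν eta) : sd ν ≤ eta := by
  have := h.prob
  refine le_of_sq_le_sq ?_ h.eta_nonneg
  rw [← h.integral_sq]
  calc ∫ x, x ^ 2 ∂ν ≤ ∫ _, eta ^ 2 ∂ν :=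
        integral_mono_ae h.integrable_sq (integrable_const _) (h.sq_mem.mono fun x hx => hx.2)
    _ = eta ^ 2 := by simp

/-- An exponential dominated by a quadratic with known mean. -/
theorem lintegral_exp_le_one (h : CenteredLaw ν eta) {k₁ k₂ k₃ B C : ℝ}
    (hq : ∀ e ∈ Set.Icc (-eta) eta, Real.exp (k₃ + k₁ * e + k₂ * e ^ 2) ≤ 1 + B * e + C * e ^ 2) :
    ∫⁻ e, ENNReal.ofReal (Real.exp ((k₃ - C * sd ν ^ 2) + k₁ * e + k₂ * e ^ 2)) ∂ν ≤ 1 := by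
  have := h.prob
  have hi : Integrable (fun e => 1 + B * e + C * e ^ 2) ν :=
    ((integrable_const _).add (h.integrable_id.const_mul B)).add (h.integrable_sq.const_mul C)
  have h1 : ∫⁻ e, ENNReal.ofReal (Real.exp (k₃ + k₁ * e + k₂ * e ^ 2)) ∂ν
      ≤ ENNReal.ofReal (1 + C * sd ν ^ 2) := by
    calc _ ≤ ∫⁻ e, ENNReal.ofReal (1 + B * e + C * e ^ 2) ∂ν :=
          lintegral_mono_ae (h.bounded.mono fun e he => ENNReal.ofReal_le_ofReal (hq e he))
      _ = ENNReal.ofReal (∫ e, (1 + B * e + C * e ^ 2) ∂ν) :=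
          (ofReal_integral_eq_lintegral_ofReal hi (h.bounded.mono fun e he =>
            (Real.exp_pos _).le.trans (hq e he))).symm
      _ = _ := by
          have i1 := h.integrable_id.const_mul B
          have i0 : Integrable (fun _ : ℝ => (1 : ℝ)) ν := integrable_const _
          have i3 : Integrable (fun e : ℝ => 1 + B * e) ν := i0.add i1
          rw [integral_add i3 (h.integrable_sq.const_mul C), integral_add i0 i1,
            integral_const_mul, integral_const_mul, h.centered, h.integral_sq]
          simp
  have h2 : ∀ e, Real.exp ((k₃ - C * sd ν ^ 2) + k₁ * e + k₂ * e ^ 2)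
      = Real.exp (-(C * sd ν ^ 2)) * Real.exp (k₃ + k₁ * e + k₂ * e ^ 2) := by
    intro e; rw [← Real.exp_add]; congr 1; ring
  simp_rw [h2, ENNReal.ofReal_mul (Real.exp_pos _).le]
  rw [lintegral_const_mul _ (by fun_prop)]
  calc _ ≤ ENNReal.ofReal (Real.exp (-(C * sd ν ^ 2))) * ENNReal.ofReal (1 + C * sd ν ^ 2) := by
        gcongr
    _ = ENNReal.ofReal (Real.exp (-(C * sd ν ^ 2)) * (1 + C * sd ν ^ 2)) :=
        (ENNReal.ofReal_mul (Real.exp_pos _).le).symm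
    _ ≤ 1 := by
        rw [ENNReal.ofReal_le_one]
        calc _ ≤ Real.exp (-(C * sd ν ^ 2)) * Real.exp (C * sd ν ^ 2) := by
              gcongr; linarith [Real.add_one_le_exp (C * sd ν ^ 2)]
          _ = 1 := by rw [← Real.exp_add]; simp

/-- Hoeffding's lemma for a bounded function of the noise. -/
theorem lintegral_exp_hoeffding (h : CenteredLaw ν eta) {f : ℝ → ℝ} (hf : Measurable f) {a b : ℝ}
    (hb : ∀ᵐ x ∂ν, f x ∈ Set.Icc a b) (l : ℝ) :
    ∫⁻ e, ENNReal.ofReal (Real.exp (l * (f e - ∫ x, f x ∂ν) - l ^ 2 * (b - a) ^ 2 / 8)) ∂ν ≤ 1 := by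
  have := h.prob
  have hs := hasSubgaussianMGF_of_mem_Icc hf.aemeasurable hb
  have h1 := hs.mgf_le l
  have h2 := hs.integrable_exp_mul l
  have e1 : ∀ e, Real.exp (l * (f e - ∫ x, f x ∂ν) - l ^ 2 * (b - a) ^ 2 / 8)
      = Real.exp (-(l ^ 2 * (b - a) ^ 2 / 8)) * Real.exp (l * (f e - ∫ x, f x ∂ν)) := by
    intro e; rw [← Real.exp_add]; congr 1; ring
  simp_rw [e1, ENNReal.ofReal_mul (Real.exp_pos _).le]
  rw [lintegral_const_mul _ (by fun_prop), ← ofReal_integral_eq_lintegral_ofReal h2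
    (Filter.Eventually.of_forall fun _ => (Real.exp_pos _).le),
    ← ENNReal.ofReal_mul (Real.exp_pos _).le, ENNReal.ofReal_le_one]
  have h3 : ∫ e, Real.exp (l * (f e - ∫ x, f x ∂ν)) ∂ν ≤ Real.exp (l ^ 2 * (b - a) ^ 2 / 8) := by
    refine h1.trans (le_of_eq ?_)
    congr 1
    push_cast
    rw [Real.norm_eq_abs, div_pow, sq_abs]
    ring
  calc _ ≤ Real.exp (-(l ^ 2 * (b - a) ^ 2 / 8)) * Real.exp (l ^ 2 * (b - a) ^ 2 / 8) := by gcongr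
    _ = 1 := by rw [← Real.exp_add]; simp

end CenteredLaw

/-! ### Elementary exponential inequalities -/

/-- Second-order Taylor expansion; the remainder constant is `4 / (3! · 3) = 2/9`. -/
theorem exp_le_of_le_of_abs_le {x h : ℝ} (hx : |x| ≤ h) (h1 : h ≤ 1) :
    Real.exp x ≤ 1 + x + (1 / 2 + 2 * h / 9) * x ^ 2 := by
  have h2 := (abs_le.1 (Real.exp_bound (hx.trans h1) (n := 3) (by norm_num))).2
  norm_num [Finset.sum_range_succ, Nat.factorial] at h2
  have h3 : |x| ^ 3 ≤ h * x ^ 2 := by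
    rw [pow_succ, sq_abs, mul_comm]; gcongr
  linarith

theorem exp_le_one_add_two_mul {x : ℝ} (h0 : 0 ≤ x) (h1 : x ≤ 1) : Real.exp x ≤ 1 + 2 * x := by
  have h := exp_le_of_le_of_abs_le (x := x) (h := 1) (by rwa [abs_of_nonneg h0]) le_rfl
  nlinarith

theorem exp_neg_sq_half_le {v : ℝ} (hv : |v| ≤ 1) : Real.exp (-(v ^ 2 / 2)) ≤ 1 - 3 / 8 * v ^ 2 := by
  have hv2 : v ^ 2 ≤ 1 := (sq_le_one_iff_abs_le_one v).2 hv
  have hy : 0 ≤ v ^ 2 / 2 := by positivity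
  have h := Real.quadratic_le_exp_of_nonneg hy
  rw [Real.exp_neg, inv_le_comm₀ (Real.exp_pos _) (by linarith)]
  refine le_trans ?_ h
  rw [inv_le_iff_one_le_mul₀ (by linarith)]
  nlinarith [mul_nonneg hy (sub_nonneg.2 hv2), mul_nonneg (mul_nonneg hy hy) (sub_nonneg.2 hv2)]

/-- The bound `1 - 3/8 v²` of `exp_neg_sq_half_le` turns negative for large `v`. For `v = 1 + a`,
adding `3/4 a²` repairs it. -/
theorem exp_neg_sq_shift_le {a : ℝ} (h0 : 0 ≤ a) :
    Real.exp (-((1 + a) ^ 2 / 2)) ≤ 5 / 8 - 3 / 4 * a + 3 / 8 * a ^ 2 := by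
  have e1 : (1.6484 : ℝ) ≤ Real.exp (1 / 2) := by
    have := Real.sum_le_exp_of_nonneg (x := 1 / 2) (by norm_num) 6
    norm_num [Finset.sum_range_succ, Nat.factorial] at this ⊢
    linarith
  have ht : 0 ≤ a + a ^ 2 / 2 := by positivity
  have e2 := Real.quadratic_le_exp_of_nonneg ht
  have e3 : Real.exp ((1 + a) ^ 2 / 2) = Real.exp (1 / 2) * Real.exp (a + a ^ 2 / 2) := by
    rw [← Real.exp_add]; congr 1; ring
  have hp : 0 < 5 / 8 - 3 / 4 * a + 3 / 8 * a ^ 2 := by nlinarith [sq_nonneg (a - 1)]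
  rw [Real.exp_neg, inv_le_comm₀ (Real.exp_pos _) hp, e3]
  have e4 : 1.6484 * (1 + (a + a ^ 2 / 2) + (a + a ^ 2 / 2) ^ 2 / 2)
      ≤ Real.exp (1 / 2) * Real.exp (a + a ^ 2 / 2) := by gcongr
  refine le_trans ?_ e4
  rw [inv_le_iff_one_le_mul₀ hp]
  have p3 : 0 ≤ a ^ 3 := by positivity
  have p4 : 0 ≤ a ^ 5 := by positivity
  have p5 : 0 ≤ a ^ 6 := by positivity
  have key : 0 ≤ 0.1467 - a + 2 * a ^ 2 - 0.5 * a ^ 3 + 0.625 * a ^ 4 := by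
    nlinarith [sq_nonneg (a - 0.27), sq_nonneg (a ^ 2 - 0.4 * a), mul_nonneg h0 (sq_nonneg (a - 0.3))]
  nlinarith

/-- The curvature `3/8` is uniform in the center `a`. The slope `B` may depend on `a`, since a
centered law annihilates the linear term. -/
theorem exists_exp_neg_sq_le (a : ℝ) : ∃ B : ℝ, ∀ x ∈ Set.Icc (-1 : ℝ) 1,
    Real.exp (-((x - a) ^ 2 / 2)) ≤ 1 + B * x - 3 / 8 * x ^ 2 := by
  -- With this slope the right side exceeds `1 - 3/8 (x - a)²`, the bound available when `|x - a| ≤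
  -- 1`, by exactly `3/8 a² (1 - x)`.
  have key : ∀ a : ℝ, 0 ≤ a → a ≤ 1 → ∀ x ∈ Set.Icc (-1 : ℝ) 1,
      Real.exp (-((x - a) ^ 2 / 2)) ≤ 1 + 3 / 8 * (2 * a - a ^ 2) * x - 3 / 8 * x ^ 2 := by
    intro a h0 h1 x hx
    rcases le_total 0 x with h | h
    · refine (exp_neg_sq_half_le (abs_le.2 ⟨by linarith, by linarith [hx.2]⟩)).trans ?_
      nlinarith [mul_nonneg (sq_nonneg a) (sub_nonneg.2 hx.2)]
    · rcases le_total (a - x) 1 with h2 | h2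
      · refine (exp_neg_sq_half_le (abs_le.2 ⟨by linarith, by linarith⟩)).trans ?_
        nlinarith [mul_nonneg (sq_nonneg a) (sub_nonneg.2 hx.2)]
      · have h3 := exp_neg_sq_shift_le (a := a - x - 1) (by linarith)
        rw [show (x - a) ^ 2 = (1 + (a - x - 1)) ^ 2 by ring]
        refine h3.trans ?_
        have hx1 := hx.1
        obtain ⟨u, rfl⟩ : ∃ u, x = u - 1 := ⟨x + 1, by ring⟩
        have hu : 0 ≤ u := by linarith
        have hau : u ≤ a := by linarith
        have hu1 : u ≤ 1 := by linarith
        nlinarith [mul_nonneg hu (sub_nonneg.2 hau), mul_nonneg (mul_nonneg hu (sub_nonneg.2 hau)) hu,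
          mul_nonneg (mul_nonneg hu (sub_nonneg.2 hau)) (sub_nonneg.2 hu1), mul_nonneg hu h0,
          mul_nonneg (mul_nonneg hu h0) (sub_nonneg.2 h1), mul_nonneg hu (sub_nonneg.2 h1)]
  have key2 : ∀ a : ℝ, 0 ≤ a → ∃ B : ℝ, ∀ x ∈ Set.Icc (-1 : ℝ) 1,
      Real.exp (-((x - a) ^ 2 / 2)) ≤ 1 + B * x - 3 / 8 * x ^ 2 := by
    intro a h0
    rcases le_total a 1 with h1 | h1
    · exact ⟨_, key a h0 h1⟩
    -- For `x ≤ 1 ≤ a`, moving the center from `a` to `1` only increases the exponential.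
    · refine ⟨_, fun x hx => le_trans ?_ (key 1 zero_le_one le_rfl x hx)⟩
      rw [Real.exp_le_exp]
      nlinarith [hx.2]
  rcases le_total 0 a with h | h
  · exact key2 a h
  · obtain ⟨B, hB⟩ := key2 (-a) (by linarith)
    refine ⟨-B, fun x hx => ?_⟩
    have := hB (-x) ⟨by linarith [hx.2], by linarith [hx.1]⟩
    rw [show (-x - -a) ^ 2 = (x - a) ^ 2 by ring] at this
    linarith

/-! ### One-step supermartingale factors for variances and means. -/

namespace CenteredLaw

/-- Squared deviations from an arbitrary center shrink the exponential by a factor governed by the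
variance. A weight `rho ≤ 1` is an exponent, handled by Bernoulli's inequality. -/
theorem lintegral_exp_neg_sq (h : CenteredLaw ν eta) (he : 0 < eta) {rho : ℝ} (h0 : 0 ≤ rho)
    (h1 : rho ≤ 1) (a : ℝ) :
    ∫⁻ e, ENNReal.ofReal (Real.exp ((-(rho * a ^ 2 / (2 * eta ^ 2))
      + 3 / 8 * rho * sd ν ^ 2 / eta ^ 2) + rho * a / eta ^ 2 * e
      + -(rho / (2 * eta ^ 2)) * e ^ 2)) ∂ν ≤ 1 := by
  obtain ⟨B, hB⟩ := exists_exp_neg_sq_le (a / eta)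
  have := h.lintegral_exp_le_one (k₁ := rho * a / eta ^ 2) (k₂ := -(rho / (2 * eta ^ 2)))
    (k₃ := -(rho * a ^ 2 / (2 * eta ^ 2))) (B := rho * B / eta) (C := -(3 / 8 * rho / eta ^ 2)) ?_
  · convert this using 6
    ring
  intro e hee
  have hx : e / eta ∈ Set.Icc (-1 : ℝ) 1 := by
    constructor
    · rw [le_div_iff₀ he]; linarith [hee.1]
    · rw [div_le_iff₀ he]; linarith [hee.2]
  have h2 := hB _ hx
  have e1 : Real.exp (-(rho * a ^ 2 / (2 * eta ^ 2)) + rho * a / eta ^ 2 * e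
      + -(rho / (2 * eta ^ 2)) * e ^ 2) = Real.exp (-((e / eta - a / eta) ^ 2 / 2)) ^ rho := by
    rw [← Real.exp_mul]; congr 1; field_simp; ring
  rw [e1]
  set q := 1 + B * (e / eta) - 3 / 8 * (e / eta) ^ 2 with hq
  have hq0 : 0 ≤ q := (Real.exp_pos _).le.trans h2
  calc _ ≤ q ^ rho := Real.rpow_le_rpow (Real.exp_pos _).le h2 h0
    _ = (1 + (q - 1)) ^ rho := by ring_nf
    _ ≤ 1 + rho * (q - 1) := rpow_one_add_le_one_add_mul_self (by linarith) h0 h1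
    _ = _ := by rw [hq]; field_simp; ring

/-- Since `e² ≤ η²`, the crude bound `exp y ≤ 1 + 2y` on `[0, 1]` suffices; it costs a factor two in
the variance upper bound. -/
theorem lintegral_exp_sq (h : CenteredLaw ν eta) (he : 0 < eta) :
    ∫⁻ e, ENNReal.ofReal (Real.exp (-(2 / eta ^ 2 * sd ν ^ 2) + 0 * e + 1 / eta ^ 2 * e ^ 2)) ∂ν
      ≤ 1 := by
  have := h.lintegral_exp_le_one (k₁ := 0) (k₂ := 1 / eta ^ 2) (k₃ := 0) (B := 0)
    (C := 2 / eta ^ 2) ?_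
  · simpa using this
  intro e hee
  have hx : e ^ 2 / eta ^ 2 ≤ 1 := by
    rw [div_le_one (by positivity)]; exact sq_le_sq' hee.1 hee.2
  have := exp_le_one_add_two_mul (by positivity) hx
  convert this using 1
  · congr 1; ring
  · ring

/-- Bernstein's inequality in exponential form, keeping the dependence of the variance coefficient
on `|l| η`. -/
theorem lintegral_exp_linear (h : CenteredLaw ν eta) {l : ℝ} (hl : |l| * eta ≤ 1) :
    ∫⁻ e, ENNReal.ofReal (Real.exp (-(l ^ 2 * (1 / 2 + 2 * (|l| * eta) / 9) * sd ν ^ 2) + l * e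
      + 0 * e ^ 2)) ∂ν ≤ 1 := by
  have := h.lintegral_exp_le_one (k₁ := l) (k₂ := 0) (k₃ := 0) (B := l)
    (C := l ^ 2 * (1 / 2 + 2 * (|l| * eta) / 9)) ?_
  · simpa using this
  intro e hee
  have hx : |l * e| ≤ |l| * eta := by
    rw [abs_mul]; gcongr; exact abs_le.2 hee
  have := exp_le_of_le_of_abs_le hx hl
  convert this using 1
  · congr 1; ring
  · ring

end CenteredLaw

end Moments

/-! ### Running statistics of a subsequence -/

section Running

/-- The rounds of `a, …, t - 1` satisfying `p`. -/
def hits (p : ℕ → Prop) [DecidablePred p] (a t : ℕ) : Finset ℕ := {s ∈ Finset.Ico a t | p s}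

/-- The mean of `y` over a finite set of rounds. -/
noncomputable def avg (y : ℕ → ℝ) (S : Finset ℕ) : ℝ := (∑ s ∈ S, y s) / S.card

variable (p : ℕ → Prop) [DecidablePred p] (a : ℕ)

theorem mem_hits {p : ℕ → Prop} [DecidablePred p] {a t s : ℕ} :
    s ∈ hits p a t ↔ (a ≤ s ∧ s < t) ∧ p s := by
  simp [hits]

theorem hits_of_le {t : ℕ} (h : t ≤ a) : hits p a t = ∅ := by
  simp [hits, Finset.Ico_eq_empty_of_le h]

theorem hits_succ_of_pos {p : ℕ → Prop} [DecidablePred p] {a t : ℕ} (h : a ≤ t) (hp : p t) :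
    hits p a (t + 1) = insert t (hits p a t) := by
  ext s; simp only [mem_hits, Finset.mem_insert]
  constructor
  · rintro ⟨⟨h1, h2⟩, h3⟩
    rcases Nat.lt_succ_iff_lt_or_eq.1 h2 with h4 | h4
    · exact Or.inr ⟨⟨h1, h4⟩, h3⟩
    · exact Or.inl h4
  · rintro (rfl | ⟨⟨h1, h2⟩, h3⟩)
    · exact ⟨⟨h, by omega⟩, hp⟩
    · exact ⟨⟨h1, by omega⟩, h3⟩

theorem hits_succ_of_neg {p : ℕ → Prop} [DecidablePred p] {a t : ℕ} (hp : ¬ p t) :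
    hits p a (t + 1) = hits p a t := by
  ext s; simp only [mem_hits]
  constructor
  · rintro ⟨⟨h1, h2⟩, h3⟩
    rcases Nat.lt_succ_iff_lt_or_eq.1 h2 with h4 | h4
    · exact ⟨⟨h1, h4⟩, h3⟩
    · subst h4; exact absurd h3 hp
  · rintro ⟨⟨h1, h2⟩, h3⟩
    exact ⟨⟨h1, by omega⟩, h3⟩

theorem notMem_hits (t : ℕ) : t ∉ hits p a t := by simp [mem_hits]

theorem hits_mono {t u : ℕ} (h : t ≤ u) : hits p a t ⊆ hits p a u := by
  intro s hs
  rw [mem_hits] at hs ⊢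
  exact ⟨⟨hs.1.1, hs.1.2.trans_le h⟩, hs.2⟩

/-- Each hit sees as many earlier hits as its own index, counted from zero. -/
theorem sum_hits_card (f : ℕ → ℝ) (t : ℕ) :
    ∑ s ∈ hits p a t, f (hits p a s).card = ∑ n ∈ Finset.range (hits p a t).card, f n := by
  induction t with
  | zero => simp [hits_of_le]
  | succ t ih =>
    by_cases h : a ≤ t
    · by_cases hp : p t
      · rw [hits_succ_of_pos h hp, Finset.sum_insert (notMem_hits p a t),
          Finset.card_insert_of_notMem (notMem_hits p a t), Finset.sum_range_succ, ih, add_comm]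
      · rw [hits_succ_of_neg hp, ih]
    · rw [hits_of_le _ _ (by omega)]; simp

/-- Cutting a subsequence at the moment when it has `N` elements. -/
theorem filter_range_eq_hits {t T : ℕ} (h : t ≤ T) :
    {s ∈ Finset.range T | p s ∧ a ≤ s ∧ (hits p a s).card < (hits p a t).card} = hits p a t := by
  ext s
  rw [Finset.mem_filter, mem_hits, Finset.mem_range]
  constructor
  · rintro ⟨_, hp, ha, hc⟩
    refine ⟨⟨ha, ?_⟩, hp⟩
    by_contra hst
    exact absurd (Finset.card_le_card (hits_mono p a (not_lt.1 hst))) (not_le.2 hc)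
  · rintro ⟨⟨ha, hst⟩, hp⟩
    refine ⟨hst.trans_le h, hp, ha, Finset.card_lt_card ⟨hits_mono p a hst.le, fun hs => ?_⟩⟩
    exact notMem_hits p a s (hs (mem_hits.2 ⟨⟨ha, hst⟩, hp⟩))

theorem sum_sq_sub_avg (y : ℕ → ℝ) (S : Finset ℕ) :
    ∑ s ∈ S, (y s - avg y S) ^ 2 = ∑ s ∈ S, y s ^ 2 - (∑ s ∈ S, y s) ^ 2 / S.card := by
  rcases S.eq_empty_or_nonempty with rfl | hS
  · simp
  have hc : (S.card : ℝ) ≠ 0 := by simp [hS.ne_empty]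
  simp only [sub_sq, Finset.sum_add_distrib, Finset.sum_sub_distrib, Finset.sum_const,
    nsmul_eq_mul, ← Finset.sum_mul, ← Finset.mul_sum, avg]
  field_simp
  ring

theorem sum_sq_sub_avg_le (y : ℕ → ℝ) (S : Finset ℕ) :
    ∑ s ∈ S, (y s - avg y S) ^ 2 ≤ ∑ s ∈ S, y s ^ 2 := by
  rw [sum_sq_sub_avg]
  have : 0 ≤ (∑ s ∈ S, y s) ^ 2 / S.card := by positivity
  linarith

theorem avg_sub_const (y : ℕ → ℝ) {S : Finset ℕ} (hS : S.Nonempty) (m : ℝ) :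
    avg (fun s => y s - m) S = avg y S - m := by
  have hc : (S.card : ℝ) ≠ 0 := by simp [hS.ne_empty]
  simp only [avg, Finset.sum_sub_distrib, Finset.sum_const, nsmul_eq_mul]
  field_simp

/-- Welford's recursion for the sum of squared deviations from the mean. -/
theorem sum_sq_sub_avg_hits (y : ℕ → ℝ) (t : ℕ) :
    ∑ s ∈ hits p a t, (y s - avg y (hits p a t)) ^ 2
      = ∑ s ∈ hits p a t, ((hits p a s).card : ℝ) / ((hits p a s).card + 1)
          * (y s - avg y (hits p a s)) ^ 2 := by
  induction t with
  | zero => simp [hits_of_le]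
  | succ t ih =>
    by_cases h : a ≤ t
    · by_cases hp : p t
      · rw [sum_sq_sub_avg] at ih ⊢
        rw [hits_succ_of_pos h hp, Finset.sum_insert (notMem_hits p a t),
          Finset.sum_insert (notMem_hits p a t), Finset.sum_insert (notMem_hits p a t),
          Finset.card_insert_of_notMem (notMem_hits p a t), ← ih, avg]
        push_cast
        have h1 : ((hits p a t).card : ℝ) + 1 ≠ 0 := by positivity
        rcases (hits p a t).eq_empty_or_nonempty with he | hne
        · simp [he]
        · have hc : ((hits p a t).card : ℝ) ≠ 0 := by simp [hne.ne_empty]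
          field_simp
          ring
      · rw [hits_succ_of_neg hp, ih]
    · rw [hits_of_le _ _ (by omega)]; simp

end Running

/-! ### Degrees of freedom -/

/-- `∑_{n < N} n / (n + 1)`. -/
noncomputable def dof (N : ℕ) : ℝ := ∑ n ∈ Finset.range N, (n : ℝ) / (n + 1)

theorem dof_succ (N : ℕ) : dof (N + 1) = dof N + N / (N + 1) := Finset.sum_range_succ _ _

/-- `dof N` is `N` minus a harmonic number. An affine minorant suffices, since every term from `n =
2` on is at least `2/3`. -/
theorem dof_ge_two_thirds (N : ℕ) : 2 / 3 * (N : ℝ) - 5 / 6 ≤ dof N := by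
  rcases Nat.lt_or_ge N 2 with h | h
  · interval_cases N <;> norm_num [dof, Finset.sum_range_succ]
  · induction N, h using Nat.le_induction with
    | base => norm_num [dof, Finset.sum_range_succ]
    | succ n hn ih =>
      rw [dof_succ]
      have h2 : (2 : ℝ) ≤ n := by exact_mod_cast hn
      have : (2 / 3 : ℝ) ≤ n / (n + 1) := by rw [le_div_iff₀ (by positivity)]; linarith
      push_cast; linarith

/-- A steeper minorant for the exploration arm `i₁`, whose pull count with each survivor is
guaranteed to be large. -/
theorem dof_ge_of_large {N : ℕ} (h : 63 ≤ N) : 63 / 64 * (N : ℝ) - 15 / 4 ≤ dof N := by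
  induction N, h using Nat.le_induction with
  | base => norm_num [dof, Finset.sum_range_succ]
  | succ n hn ih =>
    rw [dof_succ]
    have h2 : (63 : ℝ) ≤ n := by exact_mod_cast hn
    have : (63 / 64 : ℝ) ≤ n / (n + 1) := by rw [le_div_iff₀ (by positivity)]; linarith
    push_cast; linarith

/-! ### Statistics of a trajectory in terms of the noise -/

section Trajectory

variable {K M : ℕ} (mu : Fin K → ℝ) (x : ℕ → Round K M) (a t : ℕ)

/-- The noise of round `s` of a trajectory. -/
def resid (s : ℕ) : ℝ := (x s).2.2 - mu (x s).1

/-- The earlier rounds, from round `a` on, with the same arm and the same source as round `s`. -/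
def peers (s : ℕ) : Finset ℕ := pairRounds x a s (x s).1 (x s).2.1

/-- The weight of round `s` in Welford's recursion. -/
noncomputable def weight (s : ℕ) : ℝ := ((peers x a s).card : ℝ) / ((peers x a s).card + 1)

theorem weight_nonneg (s : ℕ) : 0 ≤ weight x a s := by unfold weight; positivity

theorem weight_le_one (s : ℕ) : weight x a s ≤ 1 := by
  unfold weight; rw [div_le_one (by positivity)]; linarith

theorem pairRounds_eq_hits (i : Fin K) (j : Fin M) :
    pairRounds x a t i j = hits (fun s => (x s).1 = i ∧ (x s).2.1 = j) a t := rfl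

theorem sum_pairRounds (f : ℕ → ℝ) (j : Fin M) :
    ∑ i, ∑ s ∈ pairRounds x a t i j, f s = ∑ s ∈ srcRounds x a t j, f s := by
  rw [← Finset.sum_fiberwise (srcRounds x a t j) (fun s => (x s).1) f]
  refine Finset.sum_congr rfl fun i _ => Finset.sum_congr ?_ fun _ _ => rfl
  ext s; simp only [pairRounds, srcRounds, Finset.mem_filter]; tauto

theorem sum_pairRounds' (f : ℕ → ℝ) (i : Fin K) :
    ∑ j, ∑ s ∈ pairRounds x a t i j, f s = ∑ s ∈ armRounds x a t i, f s := by
  rw [← Finset.sum_fiberwise (armRounds x a t i) (fun s => (x s).2.1) f]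
  refine Finset.sum_congr rfl fun i _ => Finset.sum_congr ?_ fun _ _ => rfl
  ext s; simp only [pairRounds, armRounds, Finset.mem_filter]; tauto

theorem sum_card_pairRounds (j : Fin M) :
    ∑ i, ((pairRounds x a t i j).card : ℝ) = (srcRounds x a t j).card := by
  have := sum_pairRounds x a t (fun _ => 1) j
  simpa using this

theorem sum_card_mul_pairRounds (i : Fin K) (v : Fin M → ℝ) :
    ∑ j, ((pairRounds x a t i j).card : ℝ) * v j = ∑ s ∈ armRounds x a t i, v (x s).2.1 := by
  rw [← sum_pairRounds' x a t (fun s => v (x s).2.1) i]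
  refine Finset.sum_congr rfl fun j _ => ?_
  rw [Finset.sum_congr rfl (g := fun _ => v j)
    (fun s hs => by rw [(Finset.mem_filter.1 hs).2.2])]
  simp

theorem avg_resid_pairRounds (i : Fin K) (j : Fin M) (h : (pairRounds x a t i j).Nonempty) :
    avg (resid mu x) (pairRounds x a t i j) = pairMean x a t i j - mu i := by
  have := avg_sub_const (fun s => (x s).2.2) h (mu i)
  rw [show pairMean x a t i j = avg (fun s => (x s).2.2) (pairRounds x a t i j) from rfl, ← this]
  unfold avg
  congr 1
  refine Finset.sum_congr rfl fun s hs => ?_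
  rw [resid, (Finset.mem_filter.1 hs).2.1]

theorem sum_sq_sub_pairMean (i : Fin K) (j : Fin M) :
    ∑ s ∈ pairRounds x a t i j, ((x s).2.2 - pairMean x a t i j) ^ 2
      = ∑ s ∈ pairRounds x a t i j,
          (resid mu x s - avg (resid mu x) (pairRounds x a t i j)) ^ 2 := by
  refine Finset.sum_congr rfl fun s hs => ?_
  rw [avg_resid_pairRounds mu x a t i j ⟨s, hs⟩, resid, (Finset.mem_filter.1 hs).2.1]
  ring

/-- The numerator of the pooled variance, by Welford's recursion. -/
theorem pooled_numerator (j : Fin M) :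
    ∑ i, ∑ s ∈ pairRounds x a t i j, ((x s).2.2 - pairMean x a t i j) ^ 2
      = ∑ s ∈ srcRounds x a t j,
          weight x a s * (resid mu x s - avg (resid mu x) (peers x a s)) ^ 2 := by
  rw [← sum_pairRounds]
  refine Finset.sum_congr rfl fun i _ => ?_
  rw [sum_sq_sub_pairMean mu, pairRounds_eq_hits, sum_sq_sub_avg_hits]
  refine Finset.sum_congr rfl fun s hs => ?_
  obtain ⟨-, h1, h2⟩ := mem_hits.1 hs
  subst h1 h2
  rfl

theorem pooled_numerator_le (j : Fin M) :
    ∑ i, ∑ s ∈ pairRounds x a t i j, ((x s).2.2 - pairMean x a t i j) ^ 2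
      ≤ ∑ s ∈ srcRounds x a t j, resid mu x s ^ 2 := by
  rw [← sum_pairRounds]
  refine Finset.sum_le_sum fun i _ => ?_
  rw [sum_sq_sub_pairMean mu]
  exact sum_sq_sub_avg_le _ _

theorem sum_weight (j : Fin M) :
    ∑ s ∈ srcRounds x a t j, weight x a s = ∑ i, dof (pairRounds x a t i j).card := by
  rw [← sum_pairRounds]
  refine Finset.sum_congr rfl fun i _ => ?_
  rw [dof, pairRounds_eq_hits, ← sum_hits_card]
  refine Finset.sum_congr rfl fun s hs => ?_
  obtain ⟨-, h1, h2⟩ := mem_hits.1 hs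
  subst h1 h2
  rfl

/-- The pair `(i₁, j)` has slope `63/64` instead of `2/3`. This surplus on its `2K + B` pulls, with
the slack `-2K/3` on the left, pays for the additive losses of all `K` arms and leaves `0.298 B`. -/
theorem sum_weight_ge (j : Fin M) (i₁ : Fin K) {B : ℝ} (hB : 128 ≤ B)
    (h : 2 * K + B ≤ ((pairRounds x a t i₁ j).card : ℝ)) :
    2 / 3 * (((srcRounds x a t j).card : ℝ) - K) + 0.298 * B
      ≤ ∑ s ∈ srcRounds x a t j, weight x a s := by
  have hK : (1 : ℝ) ≤ K := by exact_mod_cast Nat.one_le_iff_ne_zero.2 (Fin.pos i₁).ne'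
  rw [sum_weight, ← sum_card_pairRounds, ← Finset.add_sum_erase _ _ (Finset.mem_univ i₁),
    ← Finset.add_sum_erase (a := i₁) _ (fun i => dof _) (Finset.mem_univ i₁)]
  have h1 := dof_ge_of_large (N := (pairRounds x a t i₁ j).card) (by
    have : (63 : ℝ) ≤ ((pairRounds x a t i₁ j).card : ℝ) := by linarith
    exact_mod_cast this)
  have h2 : ∑ i ∈ Finset.univ.erase i₁, (2 / 3 * ((pairRounds x a t i j).card : ℝ) - 5 / 6)
      ≤ ∑ i ∈ Finset.univ.erase i₁, dof (pairRounds x a t i j).card :=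
    Finset.sum_le_sum fun i _ => dof_ge_two_thirds _
  rw [Finset.sum_sub_distrib, ← Finset.mul_sum, Finset.sum_const,
    Finset.card_erase_of_mem (Finset.mem_univ _), Finset.card_univ, Fintype.card_fin,
    nsmul_eq_mul, Nat.cast_sub (Fin.pos i₁), Nat.cast_one] at h2
  linarith

theorem armMean_eq (i : Fin K) (h : (armRounds x a t i).Nonempty) :
    armMean x a t i = mu i + avg (resid mu x) (armRounds x a t i) := by
  have := avg_sub_const (fun s => (x s).2.2) h (mu i)
  have h2 : avg (resid mu x) (armRounds x a t i) = avg (fun s => (x s).2.2 - mu i)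
      (armRounds x a t i) := by
    unfold avg
    congr 1
    refine Finset.sum_congr rfl fun s hs => ?_
    rw [resid, (Finset.mem_filter.1 hs).2]
  rw [h2, this]
  simp [armMean, avg]

end Trajectory

/-! ### The schedule of a run -/

section Schedule

variable {K M : ℕ} {p : Params M} {x : ℕ → Round K M} {i₀ i₁ : Fin K}

theorem Params.IsRun.armRounds_prep (h : p.IsRun x i₀ i₁) (hT : p.prep ≤ p.T) :
    armRounds x 0 p.prep i₀ = Finset.range p.prep := by
  ext s
  simp only [armRounds, Finset.mem_filter, Finset.mem_Ico, Finset.mem_range, Nat.zero_le,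
    true_and, and_iff_left_iff_imp]
  exact fun hs => (h.preprocess s (hs.trans_le hT) hs).1

theorem Params.IsRun.srcRounds_prep (h : p.IsRun x i₀ i₁) (hT : p.prep ≤ p.T) (ht : 1 ≤ p.tau)
    (j : Fin M) : srcRounds x 0 p.prep j = Finset.Ico (j * p.tau) (j * p.tau + p.tau) := by
  ext s
  simp only [srcRounds, Finset.mem_filter, Finset.mem_Ico, Nat.zero_le, true_and]
  have hj : (j : ℕ) * p.tau + p.tau ≤ p.prep := by
    rw [Params.prep, ← Nat.succ_mul]; exact Nat.mul_le_mul_right _ j.2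
  constructor
  · rintro ⟨hs, h1⟩
    have h2 := (h.preprocess s (hs.trans_le hT) hs).2
    rw [h1] at h2
    rw [h2]
    exact ⟨Nat.div_mul_le_self _ _, Nat.lt_div_mul_add ht⟩
  · rintro ⟨h1, h2⟩
    have hs : s < p.prep := by omega
    refine ⟨hs, Fin.ext ?_⟩
    rw [(h.preprocess s (hs.trans_le hT) hs).2]
    refine Nat.div_eq_of_lt_le h1 ?_
    rw [Nat.succ_mul]; exact h2

theorem Params.IsRun.card_srcRounds_prep (h : p.IsRun x i₀ i₁) (hT : p.prep ≤ p.T)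
    (ht : 1 ≤ p.tau) (j : Fin M) : (srcRounds x 0 p.prep j).card = p.tau := by
  rw [h.srcRounds_prep hT ht]; simp

theorem Params.start₂_le_start₃ : p.start₂ K ≤ p.start₃ x := Nat.le_add_right _ _

theorem Params.prep_le_start₂ : p.prep ≤ p.start₂ K := Nat.le_add_right _ _

theorem Params.IsRun.src_mem (h : p.IsRun x i₀ i₁) {t : ℕ} (h1 : p.prep ≤ t) (h2 : t < p.T) :
    (x t).2.1 ∈ p.surviving x := by
  rcases Nat.lt_or_ge t (p.start₂ K) with h3 | h3
  · obtain ⟨jbar, hj, -, hr⟩ := h.explore_arms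
    rw [(hr t h2 h1 h3).2]; exact hj
  rcases Nat.lt_or_ge t (p.start₃ x) with h4 | h4
  · exact (h.explore_sources t h2 h3 h4).2.1
  · exact (h.adaptive t h2 h4).2.1

theorem Params.IsRun.exists_source (h : p.IsRun x i₀ i₁) :
    ∃ jbar ∈ p.surviving x,
      ((∃ j ∈ p.surviving x, p.c ^ 2 / 2 ≤ p.preLCB x (p.delta / 3) j) →
        p.c ^ 2 / 2 ≤ p.preLCB x (p.delta / 3) jbar) ∧
      (∀ t, p.start₂ K ≤ t → p.start₂ K ≤ p.T → ∀ i,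
        p.alpha K ≤ (pairRounds x p.prep t i jbar).card) := by
  obtain ⟨jbar, hj, hl, hr⟩ := h.explore_arms
  refine ⟨jbar, hj, hl, fun t ht hT i => ?_⟩
  have hi : p.prep + i * p.alpha K + p.alpha K ≤ p.start₂ K := by
    rw [Params.start₂, add_assoc, ← Nat.succ_mul]
    exact Nat.add_le_add_left (Nat.mul_le_mul_right _ i.2) _
  have hsub : Finset.Ico (p.prep + i * p.alpha K) (p.prep + i * p.alpha K + p.alpha K)
      ⊆ pairRounds x p.prep t i jbar := by
    intro s hs
    rw [Finset.mem_Ico] at hs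
    have h1 : p.prep ≤ s := le_trans (Nat.le_add_right _ _) hs.1
    have h2 : s < p.start₂ K := by omega
    have h3 := hr s (h2.trans_le hT) h1 h2
    rw [pairRounds, Finset.mem_filter, Finset.mem_Ico]
    refine ⟨⟨h1, by omega⟩, Fin.ext ?_, h3.2⟩
    rw [h3.1]
    refine Nat.div_eq_of_lt_le (by omega) ?_
    rw [Nat.succ_mul]; omega
  simpa using Finset.card_le_card hsub

theorem card_filter_lt_strictMono {S : Finset (Fin M)} {j k : Fin M} (hj : j ∈ S)
    (h : j < k) : {l ∈ S | l < j}.card < {l ∈ S | l < k}.card := by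
  refine Finset.card_lt_card ⟨fun l hl => ?_, fun hs => ?_⟩
  · rw [Finset.mem_filter] at hl ⊢
    exact ⟨hl.1, hl.2.trans h⟩
  · have := hs (Finset.mem_filter.2 ⟨hj, h⟩)
    exact lt_irrefl _ (Finset.mem_filter.1 this).2

theorem Params.IsRun.beta_le_card (h : p.IsRun x i₀ i₁) {t : ℕ}
    (ht : p.start₃ x ≤ t) (hT : p.start₃ x ≤ p.T) {j : Fin M} (hj : j ∈ p.surviving x) :
    p.beta K ≤ (pairRounds x p.prep t i₁ j).card := by
  set r := {l ∈ p.surviving x | l < j}.card with hr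
  have hrS : r < (p.surviving x).card := by
    refine Finset.card_lt_card ⟨Finset.filter_subset _ _, fun hs => ?_⟩
    exact lt_irrefl _ (Finset.mem_filter.1 (hs hj)).2
  have hi : p.start₂ K + r * p.beta K + p.beta K ≤ p.start₃ x := by
    rw [Params.start₃, add_assoc, ← Nat.succ_mul]
    exact Nat.add_le_add_left (Nat.mul_le_mul_right _ hrS) _
  have hsub : Finset.Ico (p.start₂ K + r * p.beta K) (p.start₂ K + r * p.beta K + p.beta K)
      ⊆ pairRounds x p.prep t i₁ j := by
    intro s hs
    rw [Finset.mem_Ico] at hs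
    have h1 : p.start₂ K ≤ s := le_trans (Nat.le_add_right _ _) hs.1
    have h0 : p.prep ≤ s := Params.prep_le_start₂.trans h1
    have h2 : s < p.start₃ x := by omega
    obtain ⟨e1, e2, e3⟩ := h.explore_sources s (h2.trans_le hT) h1 h2
    rw [pairRounds, Finset.mem_filter, Finset.mem_Ico]
    refine ⟨⟨h0, by omega⟩, e1, ?_⟩
    have e4 : (s - p.start₂ K) / p.beta K = r := by
      refine Nat.div_eq_of_lt_le (by omega) ?_
      rw [Nat.succ_mul]; omega
    rw [e4] at e3
    -- The rank among the survivors is strictly monotone, so equal ranks force equal sources.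
    rcases lt_trichotomy (x s).2.1 j with h3 | h3 | h3
    · have := card_filter_lt_strictMono e2 h3; omega
    · exact h3
    · have := card_filter_lt_strictMono hj h3; omega
  simpa using Finset.card_le_card hsub

end Schedule

/-! ### The good event -/

section GoodEvent

variable {K M : ℕ} (p : Params M) (mu : Fin K → ℝ) (D : Fin M → Measure ℝ)

/-- Confidence exponent of the preprocessing phase. -/
noncomputable def Params.logPre : ℝ := Real.log (12 * M / (p.delta / 3))

/-- `√(log (36 M / δ) / τ)`. -/
noncomputable def Params.preRate : ℝ := Real.sqrt (p.logPre / p.tau)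

/-- The variance scale of `N` pulls of an arm, relative to `η² log (3 K T / δ)`. -/
noncomputable def Params.scale (K : ℕ) (N : ℕ) : ℝ :=
  N * sdMin D ^ 2 / (p.logArm K * p.eta ^ 2)

/-- A normalized exponent adapted to `N` pulls of an arm. -/
noncomputable def Params.tilt (K : ℕ) (z : ℝ) (N : ℕ) : ℝ :=
  min 1 (z / Real.sqrt (p.scale D K N))

/-- The rounds, among the first `T`, in which arm `i` is pulled after preprocessing, up to the
`N`-th such round. -/
def firstPulls (x : ℕ → Round K M) (i : Fin K) (N : ℕ) : Finset ℕ :=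
  {s ∈ Finset.range p.T | (x s).1 = i ∧ p.prep ≤ s ∧ (armRounds x p.prep s i).card < N}

/-- The deviation bounds on which the analysis rests; `i` is an optimal arm. -/
structure Good (x : ℕ → Round K M) (i : Fin K) : Prop where
  pre_sq : ∀ l ∈ ({2.8, -2.8} : Finset ℝ), ∀ j, ∑ s ∈ srcRounds x 0 p.prep j,
    (l * p.preRate / p.eta ^ 2 * (resid mu x s ^ 2 - sd (D j) ^ 2)
      - (l * p.preRate / p.eta ^ 2) ^ 2 * (p.eta ^ 2) ^ 2 / 8) ≤ p.logPre
  pre_mean : ∀ l ∈ ({1.4, -1.4} : Finset ℝ), ∀ j, ∑ s ∈ srcRounds x 0 p.prep j,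
    (l * p.preRate / p.eta * resid mu x s
      - (l * p.preRate / p.eta) ^ 2 * (2 * p.eta) ^ 2 / 8) ≤ p.logPre
  var_lower : ∀ j, ∀ t < p.T, ∑ s ∈ srcRounds x p.prep t j,
    (3 / 8 * weight x p.prep s * sd (D j) ^ 2 / p.eta ^ 2 - weight x p.prep s
      * (resid mu x s - avg (resid mu x) (peers x p.prep s)) ^ 2 / (2 * p.eta ^ 2)) ≤ p.logSrc
  var_upper : ∀ j, ∀ t < p.T, ∑ s ∈ srcRounds x p.prep t j,
    (resid mu x s ^ 2 / p.eta ^ 2 - 2 / p.eta ^ 2 * sd (D j) ^ 2) ≤ 2 * p.logSrc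
  best_lower : ∀ N < p.T, ∑ s ∈ firstPulls p x i N,
    (-(p.tilt D K 0.9 N / p.eta * resid mu x s) - (p.tilt D K 0.9 N / p.eta) ^ 2
      * (1 / 2 + 2 * p.tilt D K 0.9 N / 9) * sd (D (x s).2.1) ^ 2) ≤ p.logArm K
  arm_upper : ∀ k, ∀ N < p.T, ∑ s ∈ firstPulls p x k N,
    (p.tilt D K 1 N / p.eta * resid mu x s - (p.tilt D K 1 N / p.eta) ^ 2
      * (1 / 2 + 2 * p.tilt D K 1 N / 9) * sd (D (x s).2.1) ^ 2) ≤ 2 * p.logArm K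

theorem Params.tilt_nonneg {z : ℝ} (hz : 0 ≤ z) (N : ℕ) : 0 ≤ p.tilt D K z N :=
  le_min zero_le_one (by positivity)

theorem Params.tilt_le_one (z : ℝ) (N : ℕ) : p.tilt D K z N ≤ 1 := min_le_left _ _

end GoodEvent

/-- The trajectory of an interaction. -/
def traj {K M : ℕ} {Ω : Type*} (arm : ℕ → Ω → Fin K) (src : ℕ → Ω → Fin M) (X : ℕ → Ω → ℝ)
    (ω : Ω) : ℕ → Round K M :=
  fun t => (arm t ω, src t ω, X t ω)

theorem resid_traj {K M : ℕ} {Ω : Type*} {mu : Fin K → ℝ} {arm : ℕ → Ω → Fin K}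
    {src : ℕ → Ω → Fin M} {X : ℕ → Ω → ℝ} (s : ℕ) (ω : Ω) :
    resid mu (traj arm src X ω) s = noise mu arm X s ω := rfl

theorem filter_range_eq_srcRounds {K M : ℕ} (x : ℕ → Round K M) (a t : ℕ) (j : Fin M) :
    srcRounds x a t j = {s ∈ Finset.range t | a ≤ s ∧ (x s).2.1 = j} := by
  ext s
  simp only [srcRounds, Finset.mem_filter, Finset.mem_Ico, Finset.mem_range]
  tauto

/-! ### Failure probability of each deviation bound. -/

section Probability

variable {K M : ℕ} {p : Params M} {Ω : Type*} [mΩ : MeasurableSpace Ω] {P : Measure Ω}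
  {ℱ : Filtration ℕ mΩ} {mu : Fin K → ℝ} {D : Fin M → Measure ℝ}
  {arm : ℕ → Ω → Fin K} {src : ℕ → Ω → Fin M} {X : ℕ → Ω → ℝ}

/-- A predictable selection of rounds is a choice of coefficients: unselected rounds get zeros and
contribute the factor one. -/
theorem Interaction.measure_filter_le [IsProbabilityMeasure P]
    [∀ j, IsProbabilityMeasure (D j)] (h : Interaction P ℱ mu D arm src X)
    {c : ℕ → Ω → Prop} [∀ s ω, Decidable (c s ω)] (hc : ∀ s, MeasurableSet[ℱ s] {ω | c s ω})
    {k₀ k₁ k₂ : ℕ → Ω → ℝ} (h₀ : ∀ s, Measurable[ℱ s] (k₀ s)) (h₁ : ∀ s, Measurable[ℱ s] (k₁ s))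
    (h₂ : ∀ s, Measurable[ℱ s] (k₂ s))
    (H : ∀ s ω, c s ω → ∫⁻ e, ENNReal.ofReal (Real.exp (k₀ s ω + k₁ s ω * e + k₂ s ω * e ^ 2))
      ∂(D (src s ω)) ≤ 1) (t : ℕ) (x : ℝ) :
    P {ω | x < ∑ s ∈ Finset.range t with c s ω, (k₀ s ω + k₁ s ω * noise mu arm X s ω
      + k₂ s ω * noise mu arm X s ω ^ 2)} ≤ ENNReal.ofReal (Real.exp (-x)) := by
  have hm : ∀ k : ℕ → Ω → ℝ, (∀ s, Measurable[ℱ s] (k s)) →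
      ∀ s, Measurable[ℱ s] (fun ω => if c s ω then k s ω else 0) := fun k hk s =>
    Measurable.ite (hc s) (hk s) measurable_const
  have := h.measure_le_exp_neg (hm k₀ h₀) (hm k₁ h₁) (hm k₂ h₂) (fun s ω => ?_) t x
  · convert this using 5 with ω
    rw [Finset.sum_filter]
    refine Finset.sum_congr rfl fun s _ => ?_
    split_ifs <;> simp
  · by_cases hcs : c s ω
    · simpa only [if_pos hcs] using H s ω hcs
    · have := ‹∀ j, IsProbabilityMeasure (D j)› (src s ω)
      simp [hcs]

theorem Interaction.measurableSet_src' (h : Interaction P ℱ mu D arm src X) (t : ℕ) (j : Fin M) :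
    MeasurableSet[ℱ t] {ω | src t ω = j} := h.src_meas t (measurableSet_singleton j)

theorem Interaction.measurableSet_le_src (h : Interaction P ℱ mu D arm src X) (a s : ℕ)
    (j : Fin M) : MeasurableSet[ℱ s] {ω | a ≤ s ∧ src s ω = j} :=
  (MeasurableSet.const _).inter (h.measurableSet_src' s j)

theorem Interaction.measurableSet_arm (h : Interaction P ℱ mu D arm src X) (t : ℕ) (i : Fin K) :
    MeasurableSet[ℱ t] {ω | arm t ω = i} := h.arm_meas t (measurableSet_singleton i)

theorem Interaction.measurable_sum_armRounds (h : Interaction P ℱ mu D arm src X) (a s : ℕ)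
    (i : Fin K) : Measurable[ℱ s] fun ω => (armRounds (traj arm src X ω) a s i).card := by
  simp_rw [armRounds, Finset.card_filter]
  refine Finset.measurable_sum _ fun u hu => Measurable.ite ?_ measurable_const measurable_const
  exact ℱ.mono (Finset.mem_Ico.1 hu).2.le _ (h.measurableSet_arm u i)

theorem Interaction.measurableSet_peer (h : Interaction P ℱ mu D arm src X) {u s : ℕ} (hu : u < s) :
    MeasurableSet[ℱ s] {ω | arm u ω = arm s ω ∧ src u ω = src s ω} := by
  have h1 := (h.arm_meas u).mono (ℱ.mono hu.le) le_rfl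
  have h2 := (h.src_meas u).mono (ℱ.mono hu.le) le_rfl
  have e : {ω | arm u ω = arm s ω ∧ src u ω = src s ω}
      = (⋃ i, {ω | arm u ω = i} ∩ {ω | arm s ω = i}) ∩
        (⋃ j, {ω | src u ω = j} ∩ {ω | src s ω = j}) := by
    ext ω
    simp [eq_comm]
  rw [e]
  refine MeasurableSet.inter (MeasurableSet.iUnion fun i => ?_) (MeasurableSet.iUnion fun j => ?_)
  · exact (h1 (measurableSet_singleton i)).inter (h.measurableSet_arm s i)
  · exact (h2 (measurableSet_singleton j)).inter (h.measurableSet_src' s j)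

theorem Interaction.measurable_sum_peers (h : Interaction P ℱ mu D arm src X) (a s : ℕ)
    {f : ℕ → Ω → ℝ} (hf : ∀ u < s, Measurable[ℱ s] (f u)) :
    Measurable[ℱ s] fun ω => ∑ u ∈ peers (traj arm src X ω) a s, f u ω := by
  simp_rw [peers, pairRounds, Finset.sum_filter]
  refine Finset.measurable_sum _ fun u hu => ?_
  have hus := (Finset.mem_Ico.1 hu).2
  exact Measurable.ite (h.measurableSet_peer hus) (hf u hus) measurable_const

theorem Interaction.measurable_card_peers (h : Interaction P ℱ mu D arm src X) (a s : ℕ) :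
    Measurable[ℱ s] fun ω => ((peers (traj arm src X ω) a s).card : ℝ) := by
  have := h.measurable_sum_peers a s (f := fun _ _ => 1) fun _ _ => measurable_const
  simpa using this

theorem Interaction.measurable_weight (h : Interaction P ℱ mu D arm src X) (a s : ℕ) :
    Measurable[ℱ s] fun ω => weight (traj arm src X ω) a s :=
  (h.measurable_card_peers a s).div ((h.measurable_card_peers a s).add measurable_const)

theorem Interaction.measurable_avg (h : Interaction P ℱ mu D arm src X) (a s : ℕ) :
    Measurable[ℱ s] fun ω => avg (resid mu (traj arm src X ω)) (peers (traj arm src X ω) a s) :=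
  (h.measurable_sum_peers a s fun u hu =>
    (h.measurable_noise_succ u).mono (ℱ.mono hu) le_rfl).div (h.measurable_card_peers a s)

variable [IsProbabilityMeasure P]

theorem Interaction.measure_pre_sq (h : Interaction P ℱ mu D arm src X) (hD : NoiseLaws D p.eta)
    (l y : ℝ) (j : Fin M) :
    P {ω | y < ∑ s ∈ srcRounds (traj arm src X ω) 0 p.prep j,
      (l * (resid mu (traj arm src X ω) s ^ 2 - sd (D j) ^ 2) - l ^ 2 * (p.eta ^ 2) ^ 2 / 8)}
      ≤ ENNReal.ofReal (Real.exp (-y)) := by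
  have := hD.prob
  have key := h.measure_filter_le (c := fun s ω => src s ω = j)
    (fun s => h.measurableSet_src' s j)
    (k₀ := fun _ _ => -(l * sd (D j) ^ 2) - l ^ 2 * (p.eta ^ 2) ^ 2 / 8) (k₁ := fun _ _ => 0)
    (k₂ := fun _ _ => l) (fun _ => measurable_const) (fun _ => measurable_const)
    (fun _ => measurable_const) (fun s ω hc => ?_) p.prep y
  · convert key using 6 with ω
    · simp [srcRounds, traj]
    · rw [resid_traj]; ring
  · have := (hD.law j).lintegral_exp_hoeffding (f := fun e => e ^ 2) (by fun_prop)
      (hD.law j).sq_mem l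
    rw [hc]
    convert this using 5 with e
    rw [(hD.law j).integral_sq]; ring

theorem Interaction.measure_pre_mean (h : Interaction P ℱ mu D arm src X)
    (hD : NoiseLaws D p.eta) (l y : ℝ) (j : Fin M) :
    P {ω | y < ∑ s ∈ srcRounds (traj arm src X ω) 0 p.prep j,
      (l * resid mu (traj arm src X ω) s - l ^ 2 * (2 * p.eta) ^ 2 / 8)}
      ≤ ENNReal.ofReal (Real.exp (-y)) := by
  have := hD.prob
  have key := h.measure_filter_le (c := fun s ω => src s ω = j)
    (fun s => h.measurableSet_src' s j)
    (k₀ := fun _ _ => - (l ^ 2 * (2 * p.eta) ^ 2 / 8)) (k₁ := fun _ _ => l)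
    (k₂ := fun _ _ => 0) (fun _ => measurable_const) (fun _ => measurable_const)
    (fun _ => measurable_const) (fun s ω hc => ?_) p.prep y
  · convert key using 6 with ω
    · simp [srcRounds, traj]
    · rw [resid_traj]; ring
  · have := (hD.law j).lintegral_exp_hoeffding (f := fun e => e) (by fun_prop)
      (hD.law j).bounded l
    rw [hc]
    convert this using 5 with e
    rw [(hD.law j).centered]; ring

/-- The weight and center of round `s` in Welford's recursion depend only on earlier noise and on
the pair chosen in round `s`. They are therefore predictable, unlike the final pair mean. -/
theorem Interaction.measure_var_lower (h : Interaction P ℱ mu D arm src X)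
    (hD : NoiseLaws D p.eta) (he : 0 < p.eta) (y : ℝ) (j : Fin M) (t : ℕ) :
    P {ω | y < ∑ s ∈ srcRounds (traj arm src X ω) p.prep t j,
      (3 / 8 * weight (traj arm src X ω) p.prep s * sd (D j) ^ 2 / p.eta ^ 2
        - weight (traj arm src X ω) p.prep s * (resid mu (traj arm src X ω) s
          - avg (resid mu (traj arm src X ω)) (peers (traj arm src X ω) p.prep s)) ^ 2
            / (2 * p.eta ^ 2))}
      ≤ ENNReal.ofReal (Real.exp (-y)) := by
  have := hD.prob
  have hw := h.measurable_weight p.prep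
  have ha := h.measurable_avg p.prep
  set w : ℕ → Ω → ℝ := fun s ω => weight (traj arm src X ω) p.prep s with hwdef
  set m : ℕ → Ω → ℝ := fun s ω => avg (resid mu (traj arm src X ω))
    (peers (traj arm src X ω) p.prep s) with hmdef
  have key := h.measure_filter_le (c := fun s ω => p.prep ≤ s ∧ src s ω = j)
    (fun s => h.measurableSet_le_src p.prep s j)
    (k₀ := fun s ω => -(w s ω * m s ω ^ 2 / (2 * p.eta ^ 2))
      + 3 / 8 * w s ω * sd (D j) ^ 2 / p.eta ^ 2)
    (k₁ := fun s ω => w s ω * m s ω / p.eta ^ 2)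
    (k₂ := fun s ω => -(w s ω / (2 * p.eta ^ 2)))
    (fun s => ((((hw s).mul ((ha s).pow_const 2)).div_const _).neg).add
      ((((hw s).const_mul _).mul_const _).div_const _))
    (fun s => ((hw s).mul (ha s)).div_const _) (fun s => ((hw s).div_const _).neg)
    (fun s ω hc => ?_) t y
  · convert key using 6 with ω
    · rw [filter_range_eq_srcRounds]; rfl
    · simp only [hwdef, hmdef, resid_traj]; field_simp; ring
  · rw [hc.2]
    exact (hD.law j).lintegral_exp_neg_sq he (weight_nonneg _ _ _) (weight_le_one _ _ _) _

theorem Interaction.measure_var_upper (h : Interaction P ℱ mu D arm src X)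
    (hD : NoiseLaws D p.eta) (he : 0 < p.eta) (y : ℝ) (j : Fin M) (t : ℕ) :
    P {ω | y < ∑ s ∈ srcRounds (traj arm src X ω) p.prep t j,
      (resid mu (traj arm src X ω) s ^ 2 / p.eta ^ 2 - 2 / p.eta ^ 2 * sd (D j) ^ 2)}
      ≤ ENNReal.ofReal (Real.exp (-y)) := by
  have := hD.prob
  have key := h.measure_filter_le (c := fun s ω => p.prep ≤ s ∧ src s ω = j)
    (fun s => h.measurableSet_le_src p.prep s j)
    (k₀ := fun _ _ => -(2 / p.eta ^ 2 * sd (D j) ^ 2)) (k₁ := fun _ _ => 0)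
    (k₂ := fun _ _ => 1 / p.eta ^ 2) (fun _ => measurable_const) (fun _ => measurable_const)
    (fun _ => measurable_const) (fun s ω hc => ?_) t y
  · convert key using 6 with ω
    · rw [filter_range_eq_srcRounds]; rfl
    · rw [resid_traj]; ring
  · rw [hc.2]
    exact (hD.law j).lintegral_exp_sq he

/-- Whether round `s` is among the first `N` pulls is known before its noise. With `N`
deterministic, the tilt `l` may be tuned to `N`, although the number of pulls at a given time is
random. -/
theorem Interaction.measure_arm (h : Interaction P ℱ mu D arm src X)
    (hD : NoiseLaws D p.eta) {l : ℝ} (hl : |l| * p.eta ≤ 1) (y : ℝ) (i : Fin K) (N : ℕ) :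
    P {ω | y < ∑ s ∈ firstPulls p (traj arm src X ω) i N,
      (l * resid mu (traj arm src X ω) s - l ^ 2 * (1 / 2 + 2 * (|l| * p.eta) / 9)
        * sd (D (traj arm src X ω s).2.1) ^ 2)}
      ≤ ENNReal.ofReal (Real.exp (-y)) := by
  have := hD.prob
  have key := h.measure_filter_le
    (c := fun s ω => (arm s ω) = i ∧ p.prep ≤ s ∧
      (armRounds (traj arm src X ω) p.prep s i).card < N)
    (fun s => (h.measurableSet_arm s i).inter ((MeasurableSet.const _).inter
      ((h.measurable_sum_armRounds p.prep s i) (measurableSet_Iio (a := N)))))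
    (k₀ := fun s ω => -(l ^ 2 * (1 / 2 + 2 * (|l| * p.eta) / 9) * sd (D (src s ω)) ^ 2))
    (k₁ := fun _ _ => l) (k₂ := fun _ _ => 0)
    (fun s => (measurable_of_finite fun j =>
      -(l ^ 2 * (1 / 2 + 2 * (|l| * p.eta) / 9) * sd (D j) ^ 2)).comp (h.src_meas s))
    (fun _ => measurable_const)
    (fun _ => measurable_const) (fun s ω _ => ?_) p.T y
  · convert key using 6 with ω
    · rfl
    · rw [resid_traj]; simp only [traj]; ring
  · exact (hD.law _).lintegral_exp_linear hl

end Probability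

/-! ### The union bound. -/

section UnionBound

theorem measure_exists_lt_le {Ω ι : Type*} [MeasurableSpace Ω] {P : Measure Ω} (S : Finset ι)
    {f : ι → Ω → ℝ} {y q : ℝ} (H : ∀ a ∈ S, P {ω | y < f a ω} ≤ ENNReal.ofReal (Real.exp (-y)))
    (hq : S.card * Real.exp (-y) ≤ q) :
    P {ω | ∃ a ∈ S, y < f a ω} ≤ ENNReal.ofReal q := by
  have e : {ω | ∃ a ∈ S, y < f a ω} = ⋃ a ∈ S, {ω | y < f a ω} := by
    ext ω; simp
  rw [e]
  calc _ ≤ ∑ a ∈ S, P {ω | y < f a ω} := measure_biUnion_finset_le _ _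
    _ ≤ ∑ _a ∈ S, ENNReal.ofReal (Real.exp (-y)) := Finset.sum_le_sum H
    _ = ENNReal.ofReal (S.card * Real.exp (-y)) := by
        rw [Finset.sum_const, nsmul_eq_mul, ENNReal.ofReal_mul (by positivity),
          ENNReal.ofReal_natCast]
    _ ≤ _ := ENNReal.ofReal_le_ofReal hq

theorem measure_union_six {Ω : Type*} [MeasurableSpace Ω] {P : Measure Ω}
    {A₁ A₂ A₃ A₄ A₅ A₆ : Set Ω} {q₁ q₂ q₃ q₄ q₅ q₆ : ℝ}
    (h₁ : P A₁ ≤ ENNReal.ofReal q₁) (h₂ : P A₂ ≤ ENNReal.ofReal q₂)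
    (h₃ : P A₃ ≤ ENNReal.ofReal q₃) (h₄ : P A₄ ≤ ENNReal.ofReal q₄)
    (h₅ : P A₅ ≤ ENNReal.ofReal q₅) (h₆ : P A₆ ≤ ENNReal.ofReal q₆)
    (p₁ : 0 ≤ q₁) (p₂ : 0 ≤ q₂) (p₃ : 0 ≤ q₃) (p₄ : 0 ≤ q₄) (p₅ : 0 ≤ q₅) (p₆ : 0 ≤ q₆) :
    P (A₁ ∪ (A₂ ∪ (A₃ ∪ (A₄ ∪ (A₅ ∪ A₆))))) ≤ ENNReal.ofReal (q₁ + (q₂ + (q₃ + (q₄ + (q₅ + q₆))))) := by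
  rw [ENNReal.ofReal_add p₁ (by positivity), ENNReal.ofReal_add p₂ (by positivity),
    ENNReal.ofReal_add p₃ (by positivity), ENNReal.ofReal_add p₄ (by positivity),
    ENNReal.ofReal_add p₅ p₆]
  refine (measure_union_le _ _).trans (add_le_add h₁ ?_)
  refine (measure_union_le _ _).trans (add_le_add h₂ ?_)
  refine (measure_union_le _ _).trans (add_le_add h₃ ?_)
  refine (measure_union_le _ _).trans (add_le_add h₄ ?_)
  exact (measure_union_le _ _).trans (add_le_add h₅ h₆)

variable {K M : ℕ} {p : Params M} {Ω : Type*} [mΩ : MeasurableSpace Ω] {P : Measure Ω}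
  {ℱ : Filtration ℕ mΩ} {mu : Fin K → ℝ} {D : Fin M → Measure ℝ}
  {arm : ℕ → Ω → Fin K} {src : ℕ → Ω → Fin M} {X : ℕ → Ω → ℝ}

/-- The six families cost `δ/18 + δ/18 + δ/3 + δ/9 + δ/3 + δ/9 = δ`, with nothing to spare. This
fixes which bounds may use a doubled exponent. -/
theorem Interaction.measure_not_good_le [IsProbabilityMeasure P]
    (h : Interaction P ℱ mu D arm src X) (hD : NoiseLaws D p.eta) (he : 0 < p.eta) (hT : 1 ≤ p.T)
    (hd : 0 < p.delta) (hd1 : p.delta < 1) (hM : 1 ≤ M) (i : Fin K) :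
    P {ω | ¬ Good p mu D (traj arm src X ω) i} ≤ ENNReal.ofReal p.delta := by
  have hT' : (1 : ℝ) ≤ p.T := by exact_mod_cast hT
  have hM' : (1 : ℝ) ≤ M := by exact_mod_cast hM
  have hK' : (1 : ℝ) ≤ K := by exact_mod_cast Nat.one_le_iff_ne_zero.2 (Fin.pos i).ne'
  have e1 : Real.exp (-p.logPre) = p.delta / (36 * M) := by
    rw [Params.logPre, Real.exp_neg, Real.exp_log (by positivity)]; field_simp; norm_num
  have e2 : Real.exp (-p.logSrc) = p.delta / (3 * M * p.T) := by
    rw [Params.logSrc, Real.exp_neg, Real.exp_log (by positivity)]; field_simp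
  have e3 : Real.exp (-p.logArm K) = p.delta / (3 * K * p.T) := by
    rw [Params.logArm, Real.exp_neg, Real.exp_log (by positivity)]; field_simp
  have e4 : Real.exp (-(2 * p.logSrc)) = (p.delta / (3 * M * p.T)) ^ 2 := by
    rw [← e2, ← Real.exp_nat_mul]; congr 1; push_cast; ring
  have e5 : Real.exp (-(2 * p.logArm K)) = (p.delta / (3 * K * p.T)) ^ 2 := by
    rw [← e3, ← Real.exp_nat_mul]; congr 1; push_cast; ring
  -- A doubled exponent squares the individual probability, so the whole family costs only `δ/9`.
  have hsq : ∀ m t : ℝ, 1 ≤ m → 1 ≤ t → m * t * (p.delta / (3 * m * t)) ^ 2 ≤ p.delta / 9 := by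
    intro m t hm ht
    rw [show m * t * (p.delta / (3 * m * t)) ^ 2 = p.delta / 9 * (p.delta / (m * t)) by
      field_simp; norm_num]
    refine mul_le_of_le_one_right (by positivity) ?_
    rw [div_le_one (by positivity)]
    nlinarith
  have c2 : ∀ l : ℝ, ((({l, -l} : Finset ℝ) ×ˢ (Finset.univ : Finset (Fin M))).card : ℝ)
      ≤ 2 * M := by
    intro l
    rw [Finset.card_product, Finset.card_univ, Fintype.card_fin]
    push_cast
    gcongr
    exact_mod_cast Finset.card_le_two
  have b1 := measure_exists_lt_le (P := P) (y := p.logPre) (q := p.delta / 18)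
    (({2.8, -2.8} : Finset ℝ) ×ˢ (Finset.univ : Finset (Fin M)))
    (fun a _ => h.measure_pre_sq hD (a.1 * p.preRate / p.eta ^ 2) p.logPre a.2) (by
      refine (mul_le_mul_of_nonneg_right (c2 _) (Real.exp_pos _).le).trans (le_of_eq ?_)
      rw [e1]; field_simp; norm_num)
  have b2 := measure_exists_lt_le (P := P) (y := p.logPre) (q := p.delta / 18)
    (({1.4, -1.4} : Finset ℝ) ×ˢ (Finset.univ : Finset (Fin M)))
    (fun a _ => h.measure_pre_mean hD (a.1 * p.preRate / p.eta) p.logPre a.2) (by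
      refine (mul_le_mul_of_nonneg_right (c2 _) (Real.exp_pos _).le).trans (le_of_eq ?_)
      rw [e1]; field_simp; norm_num)
  have b3 := measure_exists_lt_le (P := P) (y := p.logSrc) (q := p.delta / 3)
    ((Finset.univ : Finset (Fin M)) ×ˢ Finset.range p.T)
    (fun a _ => h.measure_var_lower hD he p.logSrc a.1 a.2) (by
      rw [Finset.card_product, Finset.card_univ, Fintype.card_fin, Finset.card_range, e2]
      push_cast; refine le_of_eq ?_; field_simp)
  have b4 := measure_exists_lt_le (P := P) (y := 2 * p.logSrc) (q := p.delta / 9)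
    ((Finset.univ : Finset (Fin M)) ×ˢ Finset.range p.T)
    (fun a _ => h.measure_var_upper hD he (2 * p.logSrc) a.1 a.2) (by
      rw [Finset.card_product, Finset.card_univ, Fintype.card_fin, Finset.card_range, e4]
      push_cast; exact hsq _ _ hM' hT')
  have habs : ∀ z : ℝ, 0 ≤ z → ∀ N, |p.tilt D K z N / p.eta| * p.eta = p.tilt D K z N := by
    intro z hz N
    rw [abs_of_nonneg (div_nonneg (p.tilt_nonneg D hz N) he.le), div_mul_cancel₀ _ he.ne']
  -- Optimism is needed for one best arm only, so this union runs over the counts `N` alone.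
  have b5 := measure_exists_lt_le (P := P) (y := p.logArm K) (q := p.delta / 3)
    (Finset.range p.T)
    (fun N _ => h.measure_arm (p := p) hD (l := -(p.tilt D K 0.9 N / p.eta)) (by
      rw [abs_neg, habs _ (by norm_num)]; exact p.tilt_le_one D _ N) (p.logArm K) i N) (by
      rw [Finset.card_range, e3]
      rw [show (p.T : ℝ) * (p.delta / (3 * K * p.T)) = p.delta / 3 / K by field_simp]
      exact div_le_self (by positivity) hK')
  have b6 := measure_exists_lt_le (P := P) (y := 2 * p.logArm K) (q := p.delta / 9)
    ((Finset.univ : Finset (Fin K)) ×ˢ Finset.range p.T)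
    (fun a _ => h.measure_arm (p := p) hD (l := p.tilt D K 1 a.2 / p.eta) (by
      rw [habs _ (by norm_num)]; exact p.tilt_le_one D _ a.2) (2 * p.logArm K) a.1 a.2) (by
      rw [Finset.card_product, Finset.card_univ, Fintype.card_fin, Finset.card_range, e5]
      push_cast; exact hsq _ _ hK' hT')
  refine (measure_mono ?_).trans ((measure_union_six b1 b2 b3 b4 b5 b6 (by positivity)
    (by positivity) (by positivity) (by positivity) (by positivity) (by positivity)).trans
      (ENNReal.ofReal_le_ofReal (by linarith)))
  intro ω hω
  by_contra hn
  simp only [Set.mem_union, not_or] at hn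
  obtain ⟨n1, n2, n3, n4, n5, n6⟩ := hn
  refine hω ⟨fun l hl j => not_lt.1 fun hlt => n1 ⟨(l, j), ?_, hlt⟩,
    fun l hl j => not_lt.1 fun hlt => n2 ⟨(l, j), ?_, hlt⟩,
    fun j t ht => not_lt.1 fun hlt => n3 ⟨(j, t), ?_, hlt⟩,
    fun j t ht => not_lt.1 fun hlt => n4 ⟨(j, t), ?_, hlt⟩,
    fun N hN => not_lt.1 fun hlt => n5 ⟨N, ?_, ?_⟩,
    fun k N hN => not_lt.1 fun hlt => n6 ⟨(k, N), ?_, ?_⟩⟩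
  · exact Finset.mem_product.2 ⟨hl, Finset.mem_univ _⟩
  · exact Finset.mem_product.2 ⟨hl, Finset.mem_univ _⟩
  · exact Finset.mem_product.2 ⟨Finset.mem_univ _, Finset.mem_range.2 ht⟩
  · exact Finset.mem_product.2 ⟨Finset.mem_univ _, Finset.mem_range.2 ht⟩
  · exact Finset.mem_range.2 hN
  · simp only [abs_neg, habs 0.9 (by norm_num) N, neg_sq, neg_mul]
    exact hlt
  · exact Finset.mem_product.2 ⟨Finset.mem_univ _, Finset.mem_range.2 hN⟩
  · simp only [habs 1 (by norm_num) N]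
    exact hlt

end UnionBound

/-- A run of the algorithm that reaches the adaptive phase on the good event, with a surviving
source of standard deviation at least `c`. -/
structure Regime {K M : ℕ} (p : Params M) (mu : Fin K → ℝ) (D : Fin M → Measure ℝ)
    (x : ℕ → Round K M) (i₀ i₁ k : Fin K) : Prop where
  law : NoiseLaws D p.eta
  eta_pos : 0 < p.eta
  delta_pos : 0 < p.delta
  delta_lt : p.delta < 1
  c_pos : 0 < p.c
  nu_pos : 0 < p.nu
  tau_pos : 1 ≤ p.tau
  budget : p.minBudget ≤ p.tau
  run : p.IsRun x i₀ i₁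
  good : Good p mu D x k
  long : p.start₃ x < p.T
  ex : ∃ j ∈ p.surviving x, p.c ^ 2 ≤ sd (D j) ^ 2
  best : ∀ i, mu i ≤ mu k

/-! ### Accuracy of preprocessing and comparability of the surviving sources. -/

namespace Regime

variable {K M : ℕ} {p : Params M} {mu : Fin K → ℝ} {D : Fin M → Measure ℝ}
  {x : ℕ → Round K M} {i₀ i₁ k : Fin K}

theorem one_le_M (h : Regime p mu D x i₀ i₁ k) : (1 : ℝ) ≤ M := by
  obtain ⟨j, -, -⟩ := h.ex
  exact_mod_cast Nat.one_le_iff_ne_zero.2 (Fin.pos j).ne'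

theorem one_le_K (_h : Regime p mu D x i₀ i₁ k) : (1 : ℝ) ≤ K := by
  exact_mod_cast Nat.one_le_iff_ne_zero.2 (Fin.pos k).ne'

theorem prep_le (h : Regime p mu D x i₀ i₁ k) : p.prep ≤ p.T :=
  (Params.prep_le_start₂.trans Params.start₂_le_start₃).trans h.long.le

theorem one_le_T (h : Regime p mu D x i₀ i₁ k) : (1 : ℝ) ≤ p.T := by
  have := h.long
  exact_mod_cast (by omega : 1 ≤ p.T)

theorem sq_le (h : Regime p mu D x i₀ i₁ k) : p.c ^ 2 ≤ p.eta ^ 2 := by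
  obtain ⟨j, -, hj⟩ := h.ex
  exact hj.trans (pow_le_pow_left₀ (Real.sqrt_nonneg _) (h.law.law j).sd_le 2)

theorem tau_cast_pos (h : Regime p mu D x i₀ i₁ k) : (0 : ℝ) < p.tau := by
  exact_mod_cast h.tau_pos

theorem logPre_pos (h : Regime p mu D x i₀ i₁ k) : 0 < p.logPre := by
  have := h.one_le_M
  have := h.delta_pos
  have := h.delta_lt
  rw [Params.logPre]
  apply Real.log_pos
  rw [lt_div_iff₀ (by positivity)]
  linarith

theorem preRate_pos (h : Regime p mu D x i₀ i₁ k) : 0 < p.preRate :=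
  Real.sqrt_pos.2 (div_pos h.logPre_pos h.tau_cast_pos)

theorem tau_mul_preRate_sq (h : Regime p mu D x i₀ i₁ k) : p.tau * p.preRate ^ 2 = p.logPre := by
  have := h.tau_cast_pos
  rw [Params.preRate, Real.sq_sqrt (div_pos h.logPre_pos h.tau_cast_pos).le]
  field_simp

/-- Accuracy of the variance estimates of the preprocessing phase. -/
noncomputable def preError (p : Params M) : ℝ :=
  p.eta ^ 2 * (0.7072 * p.preRate + 6.01 * p.preRate ^ 2)

theorem abs_sum_sq_sub_le (h : Regime p mu D x i₀ i₁ k) (j : Fin M) :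
    |∑ s ∈ srcRounds x 0 p.prep j, resid mu x s ^ 2 - p.tau * sd (D j) ^ 2|
      ≤ p.tau * (p.eta ^ 2 * (0.7072 * p.preRate)) := by
  have hr := h.preRate_pos
  have he := h.eta_pos
  have ht := h.tau_cast_pos
  have e := h.tau_mul_preRate_sq
  have hc := h.run.card_srcRounds_prep h.prep_le h.tau_pos j
  set Q := ∑ s ∈ srcRounds x 0 p.prep j, resid mu x s ^ 2 with hQ
  -- The resulting constant is `(1 + l²/8) / |l|`, minimal at `√8`; at `2.8` it is below `0.7072`.
  have key : ∀ l : ℝ, l ∈ ({2.8, -2.8} : Finset ℝ) →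
      l * (Q - p.tau * sd (D j) ^ 2) ≤ p.tau * (p.eta ^ 2 * ((1 + l ^ 2 / 8) * p.preRate)) := by
    intro l hl
    have := h.good.pre_sq l hl j
    rw [Finset.sum_sub_distrib, ← Finset.mul_sum, Finset.sum_sub_distrib, Finset.sum_const,
      Finset.sum_const, hc, nsmul_eq_mul, nsmul_eq_mul, ← e, ← hQ] at this
    have h2 : (l * (Q - p.tau * sd (D j) ^ 2)) * (p.preRate / p.eta ^ 2)
        ≤ (p.tau * (p.eta ^ 2 * ((1 + l ^ 2 / 8) * p.preRate))) * (p.preRate / p.eta ^ 2) := by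
      have e3 : (p.tau * (p.eta ^ 2 * ((1 + l ^ 2 / 8) * p.preRate))) * (p.preRate / p.eta ^ 2)
        = p.tau * p.preRate ^ 2
          + p.tau * ((l * p.preRate / p.eta ^ 2) ^ 2 * (p.eta ^ 2) ^ 2 / 8) := by
        field_simp
      rw [e3]
      linarith [show (l * (Q - p.tau * sd (D j) ^ 2)) * (p.preRate / p.eta ^ 2)
        = l * p.preRate / p.eta ^ 2 * (Q - p.tau * sd (D j) ^ 2) by ring]
    exact le_of_mul_le_mul_right h2 (by positivity)
  have k1 := key 2.8 (by simp)
  have k2 := key (-2.8) (by simp)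
  have hpos : 0 ≤ p.tau * (p.eta ^ 2 * p.preRate) := by positivity
  rw [abs_le]
  constructor <;> nlinarith

theorem abs_sum_resid_le (h : Regime p mu D x i₀ i₁ k) (j : Fin M) :
    |∑ s ∈ srcRounds x 0 p.prep j, resid mu x s| ≤ p.tau * (p.eta * (1.415 * p.preRate)) := by
  have hr := h.preRate_pos
  have he := h.eta_pos
  have ht := h.tau_cast_pos
  have e := h.tau_mul_preRate_sq
  have hc := h.run.card_srcRounds_prep h.prep_le h.tau_pos j
  set Q := ∑ s ∈ srcRounds x 0 p.prep j, resid mu x s with hQ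
  -- Here the constant is `(1 + l²/2) / |l|`, minimal at `√2`; at `1.4` it is below `1.415`.
  have key : ∀ l : ℝ, l ∈ ({1.4, -1.4} : Finset ℝ) →
      l * Q ≤ p.tau * (p.eta * ((1 + l ^ 2 / 2) * p.preRate)) := by
    intro l hl
    have := h.good.pre_mean l hl j
    rw [Finset.sum_sub_distrib, ← Finset.mul_sum, Finset.sum_const, hc, nsmul_eq_mul, ← e,
      ← hQ] at this
    have h2 : (l * Q) * (p.preRate / p.eta)
        ≤ (p.tau * (p.eta * ((1 + l ^ 2 / 2) * p.preRate))) * (p.preRate / p.eta) := by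
      have e3 : (p.tau * (p.eta * ((1 + l ^ 2 / 2) * p.preRate))) * (p.preRate / p.eta)
        = p.tau * p.preRate ^ 2 + p.tau * ((l * p.preRate / p.eta) ^ 2 * (2 * p.eta) ^ 2 / 8) := by
        field_simp; ring
      rw [e3]
      linarith [show (l * Q) * (p.preRate / p.eta) = l * p.preRate / p.eta * Q by ring]
    exact le_of_mul_le_mul_right h2 (by positivity)
  have k1 := key 1.4 (by simp)
  have k2 := key (-1.4) (by simp)
  have hpos : 0 ≤ p.tau * (p.eta * p.preRate) := by positivity
  rw [abs_le]
  constructor <;> nlinarith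

/-- Centering at the common empirical mean, off by `m`, changes the sum of squares by at most `2|mS|
+ τ m²`. Since `3 · 1.415² < 6.01`, this is the quadratic term of `preError`. -/
theorem abs_preVar_sub_le (h : Regime p mu D x i₀ i₁ k) (j : Fin M) :
    |p.preVar x j - sd (D j) ^ 2| ≤ preError p := by
  have hr := h.preRate_pos
  have he := h.eta_pos
  have ht := h.tau_cast_pos
  have hM := h.one_le_M
  have hc := h.run.card_srcRounds_prep h.prep_le h.tau_pos j
  have hprep : (p.prep : ℝ) = M * p.tau := by rw [Params.prep]; push_cast; rfl
  set m := avg (resid mu x) (Finset.range p.prep) with hm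
  have hmabs : |m| ≤ p.eta * (1.415 * p.preRate) := by
    have e1 : ∑ s ∈ Finset.range p.prep, resid mu x s
        = ∑ j, ∑ s ∈ srcRounds x 0 p.prep j, resid mu x s := by
      rw [← Finset.sum_fiberwise (Finset.range p.prep) (fun s => (x s).2.1) (resid mu x)]
      refine Finset.sum_congr rfl fun i _ => Finset.sum_congr ?_ fun _ _ => rfl
      rw [filter_range_eq_srcRounds]; simp
    rw [hm, avg, e1, Finset.card_range, abs_div, hprep, abs_of_pos (by positivity : 0 < (M : ℝ) * p.tau),
      div_le_iff₀ (by positivity)]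
    calc _ ≤ ∑ j : Fin M, |∑ s ∈ srcRounds x 0 p.prep j, resid mu x s| :=
          Finset.abs_sum_le_sum_abs _ _
      _ ≤ ∑ _j : Fin M, p.tau * (p.eta * (1.415 * p.preRate)) :=
          Finset.sum_le_sum fun j _ => h.abs_sum_resid_le j
      _ = _ := by rw [Finset.sum_const, Finset.card_univ, Fintype.card_fin, nsmul_eq_mul]; ring
  have hne : (armRounds x 0 p.prep i₀).Nonempty := by
    rw [h.run.armRounds_prep h.prep_le, Finset.nonempty_range_iff]
    have : (0 : ℝ) < p.prep := by rw [hprep]; positivity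
    exact_mod_cast this.ne'
  have e2 : ∑ s ∈ srcRounds x 0 p.prep j, ((x s).2.2 - armMean x 0 p.prep (x s).1) ^ 2
      = ∑ s ∈ srcRounds x 0 p.prep j, resid mu x s ^ 2
        - 2 * m * ∑ s ∈ srcRounds x 0 p.prep j, resid mu x s + p.tau * m ^ 2 := by
    rw [Finset.mul_sum, ← Finset.sum_sub_distrib, ← hc, ← nsmul_eq_mul, ← Finset.sum_const,
      ← Finset.sum_add_distrib]
    refine Finset.sum_congr rfl fun s hs => ?_
    rw [srcRounds, Finset.mem_filter, Finset.mem_Ico] at hs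
    have hi := (h.run.preprocess s (hs.1.2.trans_le h.prep_le) hs.1.2).1
    rw [hi, armMean_eq mu x 0 p.prep i₀ hne, h.run.armRounds_prep h.prep_le, ← hm, resid, hi]
    ring
  have h1 := h.abs_sum_sq_sub_le j
  have h2 := h.abs_sum_resid_le j
  set S := ∑ s ∈ srcRounds x 0 p.prep j, resid mu x s
  set Q := ∑ s ∈ srcRounds x 0 p.prep j, resid mu x s ^ 2
  have h3 : |m * S| ≤ p.tau * (p.eta * (1.415 * p.preRate)) ^ 2 := by
    rw [abs_mul]
    calc _ ≤ (p.eta * (1.415 * p.preRate)) * (p.tau * (p.eta * (1.415 * p.preRate))) := by gcongr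
      _ = _ := by ring
  have h4 : m ^ 2 ≤ (p.eta * (1.415 * p.preRate)) ^ 2 := by
    rw [← sq_abs m]; gcongr
  have h5 : p.tau * m ^ 2 ≤ p.tau * (p.eta * (1.415 * p.preRate)) ^ 2 := by gcongr
  have h6 : 0 ≤ p.tau * m ^ 2 := by positivity
  have h7 : 0 ≤ p.tau * (p.eta ^ 2 * p.preRate ^ 2) := by positivity
  have e3 : p.preVar x j - sd (D j) ^ 2 = (Q - 2 * m * S + p.tau * m ^ 2 - p.tau * sd (D j) ^ 2) / p.tau := by
    rw [Params.preVar, e2, hc]; field_simp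
  rw [e3, abs_div, abs_of_pos ht, div_le_iff₀ ht, preError]
  rw [abs_le] at h1 h3 ⊢
  constructor <;> nlinarith [h1.1, h1.2, h3.1, h3.2]

/-- Preprocessing runs at level `δ/3`, while its minimal budget involves `log (12M/δ)`. The excess
`log 3` is absorbed as a fraction `b/a` of that logarithm. -/
theorem log_ratio (h : Regime p mu D x i₀ i₁ k) {a b n : ℕ} (hM : n ≤ M) (hn : 1 ≤ n)
    (hab : 3 ^ a ≤ (12 * n) ^ b) (ha : 0 < a) :
    p.logPre ≤ (1 + b / a) * Real.log (12 * M / p.delta) := by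
  have hd := h.delta_pos
  have hd1 := h.delta_lt
  have hM' := h.one_le_M
  have e1 : p.logPre = Real.log 3 + Real.log (12 * M / p.delta) := by
    rw [Params.logPre, ← Real.log_mul (by norm_num) (by positivity)]
    congr 1; field_simp
  have hn' : (1 : ℝ) ≤ n := by exact_mod_cast hn
  have e2 : a * Real.log 3 ≤ b * Real.log (12 * n) := by
    rw [← Real.log_pow, ← Real.log_pow]
    exact Real.log_le_log (by positivity) (by exact_mod_cast hab)
  have e3 : Real.log (12 * n) ≤ Real.log (12 * M / p.delta) := by
    refine Real.log_le_log (by positivity) ?_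
    rw [le_div_iff₀ hd]
    have : (n : ℝ) ≤ M := by exact_mod_cast hM
    nlinarith
  have ha' : (0 : ℝ) < a := by exact_mod_cast ha
  have e4 : Real.log 3 ≤ b / a * Real.log (12 * M / p.delta) := by
    rw [div_mul_eq_mul_div, le_div_iff₀ ha', mul_comm]
    exact e2.trans (by gcongr)
  rw [e1]; linarith

theorem rate_sq_le (h : Regime p mu D x i₀ i₁ k) {q : ℝ} (hq : 0 ≤ q)
    (hl : p.logPre ≤ q * Real.log (12 * M / p.delta)) :
    1024 * (p.eta ^ 2 * p.preRate) ^ 2 ≤ q * (p.c ^ 2) ^ 2 := by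
  have ht := h.tau_cast_pos
  have hb := h.budget
  have hc := h.c_pos
  have he := h.eta_pos
  rw [Params.minBudget, div_le_iff₀ (by positivity)] at hb
  have e := h.tau_mul_preRate_sq
  refine le_of_mul_le_mul_left ?_ ht
  calc p.tau * (1024 * (p.eta ^ 2 * p.preRate) ^ 2) = 1024 * p.eta ^ 4 * (p.tau * p.preRate ^ 2) := by
        ring
    _ ≤ 1024 * p.eta ^ 4 * (q * Real.log (12 * M / p.delta)) := by rw [e]; gcongr
    _ = q * (1024 * p.eta ^ 4 * Real.log (12 * M / p.delta)) := by ring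
    _ ≤ q * (p.tau * p.c ^ 4) := by gcongr
    _ = _ := by ring

theorem rate_le (h : Regime p mu D x i₀ i₁ k) : p.eta ^ 2 * p.preRate ≤ 0.0376 * p.c ^ 2 := by
  have hM : 1 ≤ M := by exact_mod_cast h.one_le_M
  -- `3⁹ ≤ 12⁴` gives the ratio `13/9`, and `√(13/9) / 32 < 0.0376`.
  have := h.rate_sq_le (by norm_num) (h.log_ratio (a := 9) (b := 4) (n := 1) hM le_rfl
    (by norm_num) (by norm_num))
  have hc := h.c_pos
  refine le_of_sq_le_sq (by norm_num at this; nlinarith [sq_nonneg (p.c ^ 2)]) (by positivity)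

theorem rate_le_of_two_le (h : Regime p mu D x i₀ i₁ k) (hM : 2 ≤ M) :
    p.eta ^ 2 * p.preRate ≤ 0.03626 * p.c ^ 2 := by
  -- `3²⁶ ≤ 24⁹` gives the ratio `35/26`, and `√(35/26) / 32 < 0.03626`.
  have := h.rate_sq_le (by norm_num) (h.log_ratio (a := 26) (b := 9) (n := 2) hM (by norm_num)
    (by norm_num) (by norm_num))
  have hc := h.c_pos
  refine le_of_sq_le_sq (by norm_num at this; nlinarith [sq_nonneg (p.c ^ 2)]) (by positivity)

theorem preError_le (h : Regime p mu D x i₀ i₁ k) {q : ℝ} (hq : 0 ≤ q)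
    (hl : p.eta ^ 2 * p.preRate ≤ q * p.c ^ 2) :
    preError p ≤ (0.7072 * q + 6.01 * q ^ 2) * p.c ^ 2 := by
  have hr := h.preRate_pos
  have hr2 : p.preRate ≤ q := by
    refine le_of_mul_le_mul_left (hl.trans ?_) (pow_pos h.eta_pos 2)
    rw [mul_comm]; exact mul_le_mul_of_nonneg_right h.sq_le hq
  calc preError p = (0.7072 + 6.01 * p.preRate) * (p.eta ^ 2 * p.preRate) := by
        rw [preError]; ring
    _ ≤ (0.7072 + 6.01 * q) * (q * p.c ^ 2) := by gcongr
    _ = _ := by ring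

theorem exists_sdMin (h : Regime p mu D x i₀ i₁ k) : ∃ j, sd (D j) = sdMin D := by
  obtain ⟨j, -, -⟩ := h.ex
  have : Nonempty (Fin M) := ⟨j⟩
  exact exists_eq_ciInf_of_finite

theorem sdMin_nonneg (h : Regime p mu D x i₀ i₁ k) : 0 ≤ sdMin D := by
  obtain ⟨j, hj⟩ := h.exists_sdMin
  rw [← hj]; exact Real.sqrt_nonneg _

theorem sdMin_sq_le (h : Regime p mu D x i₀ i₁ k) (j : Fin M) : sdMin D ^ 2 ≤ sd (D j) ^ 2 :=
  pow_le_pow_left₀ h.sdMin_nonneg (ciInf_le (Set.finite_range _).bddBelow j) 2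

theorem sd_sq_le_of_mem (h : Regime p mu D x i₀ i₁ k) {j : Fin M} (hj : j ∈ p.surviving x) :
    sd (D j) ^ 2 ≤ sdMin D ^ 2 + 2 * (8 * (p.eta ^ 2 * p.preRate)) + 2 * preError p := by
  obtain ⟨l, hl⟩ := h.exists_sdMin
  rw [Params.surviving, Finset.mem_filter] at hj
  have h1 := hj.2 l
  have h2 := abs_le.1 (h.abs_preVar_sub_le j)
  have h3 := abs_le.1 (h.abs_preVar_sub_le l)
  have h4 : p.preVar x j - p.preWidth (p.delta / 3) ≤ p.preUCB x (p.delta / 3) l :=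
    (le_max_left _ _).trans h1
  rw [Params.preUCB, show p.preWidth (p.delta / 3) = 8 * p.eta ^ 2 * p.preRate from rfl] at h4
  rw [← hl]
  linarith [h2.1, h3.2]

/-- A single source is its own minimum. With at least two, the sharper rate applies; the cruder
`0.0376` would give about `0.67` in place of `0.65`. -/
theorem sd_sq_le (h : Regime p mu D x i₀ i₁ k) {j : Fin M} (hj : j ∈ p.surviving x) :
    sd (D j) ^ 2 ≤ sdMin D ^ 2 + 0.65 * p.c ^ 2 := by
  have hc := h.c_pos
  rcases Nat.lt_or_ge M 2 with hM | hM
  · obtain ⟨l, hl⟩ := h.exists_sdMin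
    have : j = l := by ext; omega
    rw [← hl, ← this]; nlinarith
  · have h1 := h.sd_sq_le_of_mem hj
    have h2 := h.rate_le_of_two_le hM
    have h3 := h.preError_le (by norm_num) h2
    nlinarith

theorem le_sdMin_sq (h : Regime p mu D x i₀ i₁ k) : 0.35 * p.c ^ 2 ≤ sdMin D ^ 2 := by
  obtain ⟨j, hj, hc⟩ := h.ex
  linarith [h.sd_sq_le hj]

theorem sd_sq_le_mul (h : Regime p mu D x i₀ i₁ k) {j : Fin M} (hj : j ∈ p.surviving x) :
    sd (D j) ^ 2 ≤ 20 / 7 * sdMin D ^ 2 := by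
  linarith [h.sd_sq_le hj, h.le_sdMin_sq]

/-- Two lower bounds depend oppositely on the width `w`: the test gives `c²/2 + w - err`, the
survivor of variance at least `c²` gives `c² - 2w - 2 err`. Twice the first plus the second
eliminates `w`. -/
theorem sd_sq_ge_of_preLCB (h : Regime p mu D x i₀ i₁ k) {j : Fin M}
    (hl : p.c ^ 2 / 2 ≤ p.preLCB x (p.delta / 3) j) : 0.6 * p.c ^ 2 ≤ sd (D j) ^ 2 := by
  have hc := h.c_pos
  obtain ⟨l, hlS, hlc⟩ := h.ex
  have h1 := h.sd_sq_le_of_mem hlS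
  have h2 := h.sdMin_sq_le j
  have h3 := abs_le.1 (h.abs_preVar_sub_le j)
  have h4 := h.preError_le (by norm_num) h.rate_le
  have h5 : p.c ^ 2 / 2 ≤ p.preVar x j - 8 * p.eta ^ 2 * p.preRate := by
    rcases le_max_iff.1 hl with h6 | h6
    · exact h6
    · nlinarith
  nlinarith [h3.2]

/-- The survivor with `σ_j ≥ c` passes the `c²/2` test, so the source chosen for arm exploration
passes it too. -/
theorem exists_source (h : Regime p mu D x i₀ i₁ k) :
    ∃ j ∈ p.surviving x, 0.6 * p.c ^ 2 ≤ sd (D j) ^ 2 ∧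
      ∀ t, p.start₂ K ≤ t → ∀ i, p.alpha K ≤ (pairRounds x p.prep t i j).card := by
  obtain ⟨j, hj, hl, ha⟩ := h.run.exists_source
  refine ⟨j, hj, h.sd_sq_ge_of_preLCB (hl ?_),
    fun t ht => ha t ht (Params.start₂_le_start₃.trans h.long.le)⟩
  obtain ⟨l, hlS, hlc⟩ := h.ex
  refine ⟨l, hlS, le_trans ?_ (le_max_left _ _)⟩
  have h3 := abs_le.1 (h.abs_preVar_sub_le l)
  have h4 := h.preError_le (by norm_num) h.rate_le
  have h5 := h.rate_le
  rw [show p.preWidth (p.delta / 3) = 8 * p.eta ^ 2 * p.preRate from rfl]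
  nlinarith [h3.1]

end Regime

/-- Optimism in normalized form: `h` is the tilt and `y` the accumulated variance in units of `η²
L`. The left side is the squared Bernstein bound, the right side the squared confidence radius;
`2.32` exceeds `20/7 · 0.81`. -/
theorem ucb_poly {h y : ℝ} (h0 : 0 ≤ h) (h1 : h ≤ 1)
    (H : (h = 1 ∧ 0.6 ≤ y ∧ y ≤ 2.32) ∨ (0.81 ≤ h ^ 2 * y ∧ h ^ 2 * y ≤ 2.32)) :
    (1 + h ^ 2 * y * (1 / 2 + 2 * h / 9)) ^ 2 ≤ 8 * h ^ 2 * (0.36 * y + 0.084) := by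
  rcases H with ⟨rfl, h2, h3⟩ | ⟨h2, h3⟩
  · nlinarith
  · set q := h ^ 2 * y with hq
    have e : 8 * h ^ 2 * (0.36 * y + 0.084) = 2.88 * q + 0.672 * h ^ 2 := by rw [hq]; ring
    rw [e]
    have hb : 1 / 2 + 2 * h / 9 ≤ 13 / 18 := by linarith
    have hc : (1 / 2 + 2 * h / 9) ^ 2 * ((q - 0.81) * (2.32 - q)) ≥ 0 :=
      mul_nonneg (sq_nonneg _) (mul_nonneg (by linarith) (by linarith))
    nlinarith [mul_nonneg h0 (sub_nonneg.2 h1), mul_nonneg (mul_nonneg h0 h0) (sub_nonneg.2 h1),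
      mul_nonneg (sub_nonneg.2 h2) h0, mul_nonneg (sub_nonneg.2 h2) (sub_nonneg.2 h1),
      mul_nonneg (sub_nonneg.2 h3) h0, mul_nonneg (sub_nonneg.2 h3) (sub_nonneg.2 h1),
      mul_nonneg (mul_nonneg (sub_nonneg.2 h3) h0) (sub_nonneg.2 h1),
      mul_nonneg (mul_nonneg (sub_nonneg.2 h2) h0) (sub_nonneg.2 h1), sq_nonneg (h - 0.4)]

namespace Regime

variable {K M : ℕ} {p : Params M} {mu : Fin K → ℝ} {D : Fin M → Measure ℝ}
  {x : ℕ → Round K M} {i₀ i₁ k : Fin K}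

/-! ### Sample sizes -/

/-- The part of `beta` that controls the variance estimates. -/
noncomputable def varBudget (p : Params M) : ℝ := 16 * p.eta ^ 4 * p.logSrc / p.c ^ 4

/-- Reaching the adaptive phase forces `T ≥ τ ≥ 1024`, and `e⁸ < 3 · 1024`. -/
theorem logSrc_ge (h : Regime p mu D x i₀ i₁ k) : 8 ≤ p.logSrc := by
  have hM := h.one_le_M
  have hd := h.delta_pos
  have hd1 := h.delta_lt
  have hc := h.c_pos
  have he := h.eta_pos
  have hT := h.one_le_T
  have ht := h.tau_cast_pos
  have hl : 1 ≤ Real.log (12 * M / p.delta) := by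
    rw [Real.le_log_iff_exp_le (by positivity), le_div_iff₀ hd]
    nlinarith [Real.exp_one_lt_d9, Real.exp_pos 1]
  have hb := h.budget
  rw [Params.minBudget, div_le_iff₀ (by positivity)] at hb
  have h4 : p.c ^ 4 ≤ p.eta ^ 4 := by
    have := pow_le_pow_left₀ (by positivity) h.sq_le 2
    calc p.c ^ 4 = (p.c ^ 2) ^ 2 := by ring
      _ ≤ (p.eta ^ 2) ^ 2 := this
      _ = p.eta ^ 4 := by ring
  have ht2 : (1024 : ℝ) ≤ p.tau := by
    refine le_of_mul_le_mul_right (le_trans ?_ hb) (pow_pos hc 4)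
    calc 1024 * p.c ^ 4 ≤ 1024 * p.eta ^ 4 * 1 := by linarith
      _ ≤ _ := by gcongr
  have hT2 : (1024 : ℝ) ≤ p.T := by
    have h1 : (p.prep : ℝ) ≤ p.T := by exact_mod_cast h.prep_le
    rw [Params.prep] at h1
    push_cast at h1
    nlinarith
  rw [Params.logSrc, Real.le_log_iff_exp_le (by positivity), le_div_iff₀ hd]
  have e8 : Real.exp 8 ≤ 3072 := by
    rw [show (8 : ℝ) = ((8 : ℕ) : ℝ) * 1 by norm_num, Real.exp_nat_mul]
    calc Real.exp 1 ^ 8 ≤ 2.7182818286 ^ 8 :=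
          pow_le_pow_left₀ (Real.exp_pos 1).le Real.exp_one_lt_d9.le 8
      _ ≤ 3072 := by norm_num
  calc Real.exp 8 * p.delta ≤ 3072 * 1 := by gcongr
    _ ≤ 3 * 1 * 1024 := by norm_num
    _ ≤ 3 * M * p.T := by gcongr

theorem varBudget_ge (h : Regime p mu D x i₀ i₁ k) : 128 ≤ varBudget p := by
  have hc := h.c_pos
  have h4 : p.c ^ 4 ≤ p.eta ^ 4 := by
    have := pow_le_pow_left₀ (by positivity) h.sq_le 2
    calc p.c ^ 4 = (p.c ^ 2) ^ 2 := by ring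
      _ ≤ (p.eta ^ 2) ^ 2 := this
      _ = p.eta ^ 4 := by ring
  have := h.logSrc_ge
  rw [varBudget, le_div_iff₀ (by positivity)]
  calc 128 * p.c ^ 4 = 16 * p.c ^ 4 * 8 := by ring
    _ ≤ _ := by gcongr

theorem eta_sq_mul_logSrc_le (h : Regime p mu D x i₀ i₁ k) :
    p.eta ^ 2 * p.logSrc ≤ varBudget p * p.c ^ 2 / 16 := by
  have hc := h.c_pos
  have he := h.eta_pos
  have := h.logSrc_ge
  rw [varBudget, le_div_iff₀ (by norm_num), div_mul_eq_mul_div, le_div_iff₀ (by positivity)]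
  calc p.eta ^ 2 * p.logSrc * 16 * p.c ^ 4 = 16 * (p.eta ^ 2 * p.logSrc * p.c ^ 2) * p.c ^ 2 := by ring
    _ ≤ 16 * (p.eta ^ 2 * p.logSrc * p.c ^ 2) * p.eta ^ 2 :=
        mul_le_mul_of_nonneg_left h.sq_le (by positivity)
    _ = _ := by ring

theorem le_card_pair (h : Regime p mu D x i₀ i₁ k) {t : ℕ} (ht : p.start₃ x ≤ t) {j : Fin M}
    (hj : j ∈ p.surviving x) :
    2 * K + varBudget p ≤ ((pairRounds x p.prep t i₁ j).card : ℝ) := by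
  have h1 : (p.beta K : ℝ) ≤ ((pairRounds x p.prep t i₁ j).card : ℝ) := by
    exact_mod_cast h.run.beta_le_card ht h.long.le hj
  have h2 := Nat.le_ceil (2 * K + 4 * p.eta ^ 4 * p.logSrc / p.nu
    + 16 * p.eta ^ 4 * p.logSrc / p.c ^ 4)
  have h3 : 0 ≤ 4 * p.eta ^ 4 * p.logSrc / p.nu := by
    have := h.nu_pos
    have := h.eta_pos
    have := h.logSrc_ge
    positivity
  rw [Params.beta] at h1
  rw [varBudget]
  linarith

theorem le_card_src (h : Regime p mu D x i₀ i₁ k) {t : ℕ} (ht : p.start₃ x ≤ t) {j : Fin M}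
    (hj : j ∈ p.surviving x) :
    2 * K + varBudget p ≤ ((srcRounds x p.prep t j).card : ℝ) := by
  refine (h.le_card_pair ht hj).trans ?_
  rw [← sum_card_pairRounds]
  exact Finset.single_le_sum (f := fun i => ((pairRounds x p.prep t i j).card : ℝ))
    (fun _ _ => Nat.cast_nonneg _) (Finset.mem_univ i₁)

/-! ### Accuracy of the variance estimates -/

/-- The numerator is at least `3/4 σ²` times the total weight, minus `2 η² logSrc`. Thus `0.5 = 3/4
· 2/3` and `0.2235 = 3/4 · 0.298`. -/
theorem pooled_numerator_ge (h : Regime p mu D x i₀ i₁ k) {t : ℕ} (ht : p.start₃ x ≤ t)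
    (htT : t < p.T) {j : Fin M} (hj : j ∈ p.surviving x) :
    0.5 * sd (D j) ^ 2 * (((srcRounds x p.prep t j).card : ℝ) - K)
      + (0.2235 * sd (D j) ^ 2 - p.c ^ 2 / 8) * varBudget p
      ≤ ∑ i, ∑ s ∈ pairRounds x p.prep t i j, ((x s).2.2 - pairMean x p.prep t i j) ^ 2 := by
  have he := h.eta_pos
  rw [pooled_numerator mu]
  have h1 := h.good.var_lower j t htT
  set W := ∑ s ∈ srcRounds x p.prep t j, weight x p.prep s with hW
  set N := ∑ s ∈ srcRounds x p.prep t j, weight x p.prep s * (resid mu x s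
    - avg (resid mu x) (peers x p.prep s)) ^ 2 with hN
  have e1 : ∑ s ∈ srcRounds x p.prep t j,
    (3 / 8 * weight x p.prep s * sd (D j) ^ 2 / p.eta ^ 2 - weight x p.prep s
      * (resid mu x s - avg (resid mu x) (peers x p.prep s)) ^ 2 / (2 * p.eta ^ 2))
      = (3 / 8 * sd (D j) ^ 2 * W - N / 2) / p.eta ^ 2 := by
    rw [Finset.sum_sub_distrib, ← Finset.sum_div, ← Finset.sum_div, ← Finset.sum_mul,
      ← Finset.mul_sum, ← hW, ← hN]
    field_simp
  rw [e1, div_le_iff₀ (by positivity)] at h1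
  have h2 := sum_weight_ge x p.prep t j i₁ h.varBudget_ge (h.le_card_pair ht hj)
  have h3 := h.eta_sq_mul_logSrc_le
  have h4 := mul_le_mul_of_nonneg_left h2 (sq_nonneg (sd (D j)))
  nlinarith

/-- Since `0.2235 · 0.6 > 1/8`, the budget term is nonnegative and can be dropped. -/
theorem pooledVar_ge_half (h : Regime p mu D x i₀ i₁ k) {t : ℕ} (ht : p.start₃ x ≤ t)
    (htT : t < p.T) {j : Fin M} (hj : j ∈ p.surviving x) (hs : 0.6 * p.c ^ 2 ≤ sd (D j) ^ 2) :
    0.5 * sd (D j) ^ 2 ≤ pooledVar x p.prep t j := by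
  have h1 := h.pooled_numerator_ge ht htT hj
  have h2 := h.le_card_src ht hj
  have h3 := h.varBudget_ge
  have hK := h.one_le_K
  have hc := sq_nonneg p.c
  rw [pooledVar, le_div_iff₀ (by linarith)]
  refine le_trans ?_ h1
  have : 0 ≤ (0.2235 * sd (D j) ^ 2 - p.c ^ 2 / 8) * varBudget p :=
    mul_nonneg (by linarith) (by linarith)
  linarith

/-- With only `σ² ≥ 0.35 c²` the budget term may be negative, but not below `-0.14 σ² B`, and `B ≤ m
- K`. -/
theorem pooledVar_ge (h : Regime p mu D x i₀ i₁ k) {t : ℕ} (ht : p.start₃ x ≤ t)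
    (htT : t < p.T) {j : Fin M} (hj : j ∈ p.surviving x) :
    0.36 * sd (D j) ^ 2 ≤ pooledVar x p.prep t j := by
  have h1 := h.pooled_numerator_ge ht htT hj
  have h2 := h.le_card_src ht hj
  have h3 := h.varBudget_ge
  have hK := h.one_le_K
  have hs := h.le_sdMin_sq.trans (h.sdMin_sq_le j)
  rw [pooledVar, le_div_iff₀ (by linarith)]
  refine le_trans ?_ h1
  have h4 : (-0.14 * sd (D j) ^ 2) * varBudget p
      ≤ (0.2235 * sd (D j) ^ 2 - p.c ^ 2 / 8) * varBudget p := by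
    have := sq_nonneg p.c
    gcongr
    linarith
  have h5 : sd (D j) ^ 2 * varBudget p
      ≤ sd (D j) ^ 2 * (((srcRounds x p.prep t j).card : ℝ) - K) := by
    gcongr
    linarith
  linarith

/-- The factor two of `lintegral_exp_sq` and `m ≤ 2 (m - K)` give `4`; the logarithmic term adds at
most `20/7 · 1/8 < 1`. -/
theorem pooledVar_le (h : Regime p mu D x i₀ i₁ k) {t : ℕ} (ht : p.start₃ x ≤ t)
    (htT : t < p.T) {j : Fin M} (hj : j ∈ p.surviving x) :
    pooledVar x p.prep t j ≤ 5 * sd (D j) ^ 2 := by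
  have he := h.eta_pos
  have h1 := (pooled_numerator_le mu x p.prep t j)
  have h2 := h.le_card_src ht hj
  have h3 := h.varBudget_ge
  have hK := h.one_le_K
  have hs := h.le_sdMin_sq.trans (h.sdMin_sq_le j)
  have h4 := h.good.var_upper j t htT
  rw [Finset.sum_sub_distrib, ← Finset.sum_div, Finset.sum_const, nsmul_eq_mul] at h4
  have h5 := h.eta_sq_mul_logSrc_le
  set Q := ∑ s ∈ srcRounds x p.prep t j, resid mu x s ^ 2
  set m := ((srcRounds x p.prep t j).card : ℝ)
  have h6 : Q ≤ 2 * m * sd (D j) ^ 2 + 2 * (p.eta ^ 2 * p.logSrc) := by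
    have e : Q / p.eta ^ 2 - m * (2 / p.eta ^ 2 * sd (D j) ^ 2)
        = (Q - 2 * m * sd (D j) ^ 2) / p.eta ^ 2 := by ring
    rw [e, div_le_iff₀ (by positivity)] at h4
    linarith
  rw [pooledVar, div_le_iff₀ (by linarith)]
  have h7 : varBudget p * p.c ^ 2 ≤ (m - K) * (20 / 7 * sd (D j) ^ 2) := by
    refine mul_le_mul (by linarith) (by linarith) (sq_nonneg _) (by linarith)
  have h8 : m * sd (D j) ^ 2 ≤ 2 * (m - K) * sd (D j) ^ 2 := by
    gcongr
    linarith
  have h9 : 0 ≤ (m - K) * sd (D j) ^ 2 := mul_nonneg (by linarith) (sq_nonneg _)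
  nlinarith

/-! ### Accuracy of the arm means -/

/-- Sum of the noise variances over the pulls of arm `i`. -/
noncomputable def armVar (p : Params M) (D : Fin M → Measure ℝ) (x : ℕ → Round K M) (t : ℕ)
    (i : Fin K) : ℝ := ∑ s ∈ armRounds x p.prep t i, sd (D (x s).2.1) ^ 2

theorem armVar_eq (t : ℕ) (i : Fin K) :
    armVar p D x t i = ∑ j, ((pairRounds x p.prep t i j).card : ℝ) * sd (D j) ^ 2 :=
  (sum_card_mul_pairRounds x p.prep t i fun j => sd (D j) ^ 2).symm

theorem src_mem_of_mem (h : Regime p mu D x i₀ i₁ k) {t s : ℕ} (htT : t < p.T) {i : Fin K}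
    (hs : s ∈ armRounds x p.prep t i) : (x s).2.1 ∈ p.surviving x := by
  rw [armRounds, Finset.mem_filter, Finset.mem_Ico] at hs
  exact h.run.src_mem hs.1.1 (hs.1.2.trans htT)

theorem mem_of_card_ne_zero (h : Regime p mu D x i₀ i₁ k) {t : ℕ} (htT : t < p.T) {i : Fin K}
    {j : Fin M} (hc : (pairRounds x p.prep t i j).card ≠ 0) : j ∈ p.surviving x := by
  obtain ⟨s, hs⟩ := Finset.card_pos.1 (Nat.pos_of_ne_zero hc)
  rw [pairRounds, Finset.mem_filter, Finset.mem_Ico] at hs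
  rw [← hs.2.2]
  exact h.run.src_mem hs.1.1 (hs.1.2.trans htT)

theorem armVar_le (h : Regime p mu D x i₀ i₁ k) {t : ℕ} (htT : t < p.T) (i : Fin K) :
    armVar p D x t i ≤ (armRounds x p.prep t i).card * (20 / 7 * sdMin D ^ 2) := by
  rw [armVar, ← nsmul_eq_mul]
  exact Finset.sum_le_card_nsmul _ _ _ fun s hs => h.sd_sq_le_mul (h.src_mem_of_mem htT hs)

theorem le_armVar (h : Regime p mu D x i₀ i₁ k) (t : ℕ) (i : Fin K) :
    (armRounds x p.prep t i).card * sdMin D ^ 2 ≤ armVar p D x t i := by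
  rw [armVar, ← nsmul_eq_mul]
  exact Finset.card_nsmul_le_sum _ _ _ fun s _ => h.sdMin_sq_le _

/-- Sum of the estimated noise variances over the pulls of arm `i`. -/
noncomputable def armVarEst (p : Params M) (x : ℕ → Round K M) (t : ℕ) (i : Fin K) : ℝ :=
  ∑ j, ((pairRounds x p.prep t i j).card : ℝ) * pooledVar x p.prep t j

theorem armVarEst_le (h : Regime p mu D x i₀ i₁ k) {t : ℕ} (ht : p.start₃ x ≤ t)
    (htT : t < p.T) (i : Fin K) : armVarEst p x t i ≤ 5 * armVar p D x t i := by
  rw [armVarEst, armVar_eq, Finset.mul_sum]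
  refine Finset.sum_le_sum fun j _ => ?_
  by_cases hc : (pairRounds x p.prep t i j).card = 0
  · simp [hc]
  · have := h.pooledVar_le ht htT (h.mem_of_card_ne_zero htT hc)
    calc _ ≤ ((pairRounds x p.prep t i j).card : ℝ) * (5 * sd (D j) ^ 2) := by gcongr
      _ = _ := by ring

theorem logArm_pos (h : Regime p mu D x i₀ i₁ k) : 0 < p.logArm K := by
  have := h.one_le_K
  have := h.one_le_T
  have := h.delta_pos
  have := h.delta_lt
  rw [Params.logArm]
  apply Real.log_pos
  rw [lt_div_iff₀ (by positivity)]
  nlinarith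

theorem exists_pair (h : Regime p mu D x i₀ i₁ k) :
    ∃ j ∈ p.surviving x, 0.6 * p.c ^ 2 ≤ sd (D j) ^ 2 ∧ ∀ t, p.start₃ x ≤ t → ∀ i,
      p.eta ^ 2 * p.logArm K ≤ ((pairRounds x p.prep t i j).card : ℝ) * p.c ^ 2 := by
  obtain ⟨j, hj, hs, ha⟩ := h.exists_source
  refine ⟨j, hj, hs, fun t ht i => ?_⟩
  have h1 : (p.alpha K : ℝ) ≤ ((pairRounds x p.prep t i j).card : ℝ) := by
    exact_mod_cast ha t (Params.start₂_le_start₃.trans ht) i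
  have h2 := (Nat.le_ceil (p.eta ^ 2 * p.logArm K / p.c ^ 2)).trans h1
  rwa [div_le_iff₀ (pow_pos h.c_pos 2)] at h2

theorem card_pair_le (t : ℕ) (i : Fin K) (j : Fin M) :
    (pairRounds x p.prep t i j).card ≤ (armRounds x p.prep t i).card := by
  refine Finset.card_le_card fun s hs => ?_
  rw [pairRounds, Finset.mem_filter] at hs
  exact Finset.mem_filter.2 ⟨hs.1, hs.2.1⟩

theorem le_card_arm (h : Regime p mu D x i₀ i₁ k) {t : ℕ} (ht : p.start₃ x ≤ t) (i : Fin K) :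
    p.eta ^ 2 * p.logArm K ≤ ((armRounds x p.prep t i).card : ℝ) * p.c ^ 2 := by
  obtain ⟨j, -, -, ha⟩ := h.exists_pair
  refine (ha t ht i).trans ?_
  have : ((pairRounds x p.prep t i j).card : ℝ) ≤ (armRounds x p.prep t i).card := by
    exact_mod_cast card_pair_le t i j
  gcongr

theorem card_arm_pos (h : Regime p mu D x i₀ i₁ k) {t : ℕ} (ht : p.start₃ x ≤ t) (i : Fin K) :
    0 < (armRounds x p.prep t i).card := by
  have h1 := h.le_card_arm ht i
  have h2 := mul_pos (pow_pos h.eta_pos 2) h.logArm_pos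
  refine Nat.pos_of_ne_zero fun h3 => ?_
  rw [h3, Nat.cast_zero, zero_mul] at h1
  linarith

/-- The pulls with the initial source carry variance at least `0.6 η² L`. Their estimate has ratio
`0.5` rather than `0.36`, whence the bonus `0.084 = 0.14 · 0.6`. -/
theorem le_armVar_and_armVarEst (h : Regime p mu D x i₀ i₁ k) {t : ℕ} (ht : p.start₃ x ≤ t)
    (htT : t < p.T) (i : Fin K) :
    0.6 * (p.eta ^ 2 * p.logArm K) ≤ armVar p D x t i ∧
      0.36 * armVar p D x t i + 0.084 * (p.eta ^ 2 * p.logArm K) ≤ armVarEst p x t i := by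
  obtain ⟨j, hj, hs, ha⟩ := h.exists_pair
  have h1 := ha t ht i
  have h2 : 0.6 * (p.eta ^ 2 * p.logArm K)
      ≤ ((pairRounds x p.prep t i j).card : ℝ) * sd (D j) ^ 2 := by
    calc _ ≤ 0.6 * (((pairRounds x p.prep t i j).card : ℝ) * p.c ^ 2) := by gcongr
      _ = ((pairRounds x p.prep t i j).card : ℝ) * (0.6 * p.c ^ 2) := by ring
      _ ≤ _ := by gcongr
  constructor
  · rw [armVar_eq]
    exact h2.trans (Finset.single_le_sum
      (f := fun j => ((pairRounds x p.prep t i j).card : ℝ) * sd (D j) ^ 2)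
      (fun _ _ => by positivity) (Finset.mem_univ j))
  · have h3 : ((pairRounds x p.prep t i j).card : ℝ)
        * (pooledVar x p.prep t j - 0.36 * sd (D j) ^ 2) ≤ armVarEst p x t i
        - 0.36 * armVar p D x t i := by
      rw [armVar_eq, armVarEst, Finset.mul_sum, ← Finset.sum_sub_distrib]
      have := Finset.single_le_sum (f := fun j => ((pairRounds x p.prep t i j).card : ℝ)
        * (pooledVar x p.prep t j - 0.36 * sd (D j) ^ 2)) (s := Finset.univ) (fun l _ => ?_)
        (Finset.mem_univ j)
      · refine this.trans (le_of_eq (Finset.sum_congr rfl fun l _ => by ring))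
      · by_cases hc : (pairRounds x p.prep t i l).card = 0
        · simp [hc]
        · have := h.pooledVar_ge ht htT (h.mem_of_card_ne_zero htT hc)
          exact mul_nonneg (Nat.cast_nonneg _) (by linarith)
    have h4 := h.pooledVar_ge_half ht htT hj hs
    have h5 : ((pairRounds x p.prep t i j).card : ℝ) * (0.14 * sd (D j) ^ 2)
        ≤ ((pairRounds x p.prep t i j).card : ℝ)
        * (pooledVar x p.prep t j - 0.36 * sd (D j) ^ 2) := by
      gcongr
      linarith
    linarith

theorem card_arm_lt (htT : t < p.T) (i : Fin K) : (armRounds x p.prep t i).card < p.T := by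
  refine lt_of_le_of_lt (Finset.card_filter_le _ _) ?_
  rw [Nat.card_Ico]; omega

theorem firstPulls_eq {t : ℕ} (htT : t < p.T) (i : Fin K) :
    firstPulls p x i (armRounds x p.prep t i).card = armRounds x p.prep t i :=
  filter_range_eq_hits (fun s => (x s).1 = i) p.prep htT.le

end Regime

/-! ### Optimism and confidence widths of the arms. -/

namespace Regime

variable {K M : ℕ} {p : Params M} {mu : Fin K → ℝ} {D : Fin M → Measure ℝ}
  {x : ℕ → Round K M} {i₀ i₁ k : Fin K}

theorem sdMin_pos (h : Regime p mu D x i₀ i₁ k) : 0 < sdMin D := by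
  have h1 := h.le_sdMin_sq
  have h2 := pow_pos h.c_pos 2
  exact lt_of_le_of_ne h.sdMin_nonneg fun h3 => by rw [← h3] at h1; nlinarith

theorem scale_ge (h : Regime p mu D x i₀ i₁ k) {t : ℕ} (ht : p.start₃ x ≤ t) (i : Fin K) :
    0.35 ≤ p.scale D K (armRounds x p.prep t i).card := by
  have hL := h.logArm_pos
  have he := h.eta_pos
  have h1 := h.le_card_arm ht i
  rw [Params.scale, le_div_iff₀ (by positivity)]
  calc 0.35 * (p.logArm K * p.eta ^ 2) = 0.35 * (p.eta ^ 2 * p.logArm K) := by ring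
    _ ≤ 0.35 * (((armRounds x p.prep t i).card : ℝ) * p.c ^ 2) := by gcongr
    _ = ((armRounds x p.prep t i).card : ℝ) * (0.35 * p.c ^ 2) := by ring
    _ ≤ _ := by gcongr; exact h.le_sdMin_sq

theorem scale_mul (h : Regime p mu D x i₀ i₁ k) (N : ℕ) :
    p.scale D K N * (p.eta ^ 2 * p.logArm K) = N * sdMin D ^ 2 := by
  have hL := h.logArm_pos
  have he := h.eta_pos
  rw [Params.scale]
  field_simp

theorem neg_sum_resid_le (h : Regime p mu D x i₀ i₁ k) {t : ℕ} (ht : p.start₃ x ≤ t)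
    (htT : t < p.T) :
    -∑ s ∈ armRounds x p.prep t k, resid mu x s
      ≤ 2 * Real.sqrt (2 * p.logArm K * armVarEst p x t k) := by
  have hL := h.logArm_pos
  have he := h.eta_pos
  have hG : 0 < p.eta ^ 2 * p.logArm K := by positivity
  have h1 := h.good.best_lower _ (card_arm_lt (x := x) htT k)
  rw [firstPulls_eq htT] at h1
  obtain ⟨h2, h3⟩ := h.le_armVar_and_armVarEst ht htT k
  have h4 := h.armVar_le htT k
  have h5 := h.le_armVar t k
  have h6 := h.scale_mul (armRounds x p.prep t k).card
  have h7 := h.scale_ge ht k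
  set S := ∑ s ∈ armRounds x p.prep t k, resid mu x s with hS
  set n := (armRounds x p.prep t k).card
  set u := p.scale D K n with hu
  set a := p.tilt D K 0.9 n with ha
  have ha1 : a ≤ 1 := p.tilt_le_one D _ _
  have hsu : 0 < Real.sqrt u := Real.sqrt_pos.2 (by linarith)
  have hsu2 : Real.sqrt u ^ 2 = u := Real.sq_sqrt (by linarith)
  have ha0 : 0 < a := lt_min one_pos (by positivity)
  obtain ⟨y, hy⟩ : ∃ y, armVar p D x t k = y * (p.eta ^ 2 * p.logArm K) :=
    ⟨armVar p D x t k / (p.eta ^ 2 * p.logArm K), by field_simp⟩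
  rw [hy] at h2 h3 h4 h5
  rw [← h6] at h5
  rw [show (n : ℝ) * (20 / 7 * sdMin D ^ 2) = 20 / 7 * (n * sdMin D ^ 2) by ring, ← h6,
    ← mul_assoc (20 / 7)] at h4
  have y1 : 0.6 ≤ y := le_of_mul_le_mul_right h2 hG
  have y2 : y ≤ 20 / 7 * u := le_of_mul_le_mul_right h4 hG
  have y3 : u ≤ y := le_of_mul_le_mul_right h5 hG
  -- The two cases of the tilt are the two alternatives of `ucb_poly`; `u ≤ y ≤ 20/7 u` locates `y`.
  have hpoly : (1 + a ^ 2 * y * (1 / 2 + 2 * a / 9)) ^ 2 ≤ 8 * a ^ 2 * (0.36 * y + 0.084) := by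
    refine ucb_poly ha0.le ha1 ?_
    rcases le_total 1 (0.9 / Real.sqrt u) with hc | hc
    · left
      have : a = 1 := min_eq_left hc
      rw [le_div_iff₀ hsu] at hc
      refine ⟨this, y1, ?_⟩
      nlinarith
    · right
      have h8 : a = 0.9 / Real.sqrt u := min_eq_right hc
      have h9 : a ^ 2 * u = 0.81 := by
        rw [h8, div_pow, hsu2]; field_simp; norm_num
      constructor <;> nlinarith [sq_nonneg a]
  have e1 : ∑ s ∈ armRounds x p.prep t k, (-(a / p.eta * resid mu x s)
      - (a / p.eta) ^ 2 * (1 / 2 + 2 * a / 9) * sd (D (x s).2.1) ^ 2)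
      = a / p.eta * (-S) - (a ^ 2 * y * (1 / 2 + 2 * a / 9)) * p.logArm K := by
    rw [Finset.sum_sub_distrib, Finset.sum_neg_distrib, ← Finset.mul_sum, ← Finset.mul_sum,
      ← hS, ← show armVar p D x t k = ∑ s ∈ armRounds x p.prep t k, sd (D (x s).2.1) ^ 2 from rfl,
      hy]
    field_simp
  rw [e1] at h1
  set R := Real.sqrt (2 * p.logArm K * armVarEst p x t k) with hR
  have hV : 0 ≤ armVarEst p x t k := le_trans (by positivity) h3
  have hR2 : R ^ 2 = 2 * p.logArm K * armVarEst p x t k := Real.sq_sqrt (by positivity)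
  have hR0 : 0 ≤ R := Real.sqrt_nonneg _
  have key : (1 + a ^ 2 * y * (1 / 2 + 2 * a / 9)) * p.logArm K ≤ a / p.eta * (2 * R) := by
    refine le_of_sq_le_sq ?_ (by positivity)
    rw [mul_pow, mul_pow, mul_pow, hR2, div_pow]
    calc _ ≤ 8 * a ^ 2 * (0.36 * y + 0.084) * p.logArm K ^ 2 := by gcongr
      _ = a ^ 2 / p.eta ^ 2 * (2 ^ 2 * (2 * p.logArm K
          * (0.36 * (y * (p.eta ^ 2 * p.logArm K)) + 0.084 * (p.eta ^ 2 * p.logArm K)))) := by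
        field_simp; ring
      _ ≤ _ := by gcongr
  have hpos : 0 < a / p.eta := by positivity
  refine le_of_mul_le_mul_left ?_ hpos
  linarith

theorem sum_resid_le (h : Regime p mu D x i₀ i₁ k) {t : ℕ} (ht : p.start₃ x ≤ t)
    (htT : t < p.T) (i : Fin K) :
    ∑ s ∈ armRounds x p.prep t i, resid mu x s
      ≤ 7 * (Real.sqrt ((armRounds x p.prep t i).card * p.logArm K) * sdMin D) := by
  have hL := h.logArm_pos
  have he := h.eta_pos
  have hm := h.sdMin_pos
  have h1 := h.good.arm_upper i _ (card_arm_lt (x := x) htT i)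
  rw [firstPulls_eq htT] at h1
  have h4 := h.armVar_le htT i
  have h6 := h.scale_mul (armRounds x p.prep t i).card
  have h7 := h.scale_ge ht i
  set S := ∑ s ∈ armRounds x p.prep t i, resid mu x s with hS
  set n := (armRounds x p.prep t i).card
  set u := p.scale D K n with hu
  set a := p.tilt D K 1 n with ha
  have ha1 : a ≤ 1 := p.tilt_le_one D _ _
  have hsu : 0 < Real.sqrt u := Real.sqrt_pos.2 (by linarith)
  have hsu2 : Real.sqrt u ^ 2 = u := Real.sq_sqrt (by linarith)
  have ha0 : 0 < a := lt_min one_pos (by positivity)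
  have hau : a * Real.sqrt u ≤ 1 := by
    have : a ≤ 1 / Real.sqrt u := min_le_right _ _
    rwa [le_div_iff₀ hsu] at this
  have hau2 : a ^ 2 * u ≤ 1 := by
    rw [← hsu2, ← mul_pow]; exact pow_le_one₀ (by positivity) hau
  -- When the tilt is capped at one, `u ≥ 0.35` suffices: `7 √0.35 > 4.07`.
  have hau3 : 4.07 ≤ a * (7 * Real.sqrt u) := by
    rcases le_total 1 (1 / Real.sqrt u) with hc | hc
    · rw [show a = 1 from min_eq_left hc]
      nlinarith
    · rw [show a = 1 / Real.sqrt u from min_eq_right hc]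
      field_simp; norm_num
  have e2 : Real.sqrt (n * p.logArm K) * sdMin D = Real.sqrt u * (p.eta * p.logArm K) := by
    have e3 : n * p.logArm K * sdMin D ^ 2 = u * (p.eta * p.logArm K) ^ 2 := by
      linear_combination -p.logArm K * h6
    have e4 := congrArg Real.sqrt e3
    rwa [Real.sqrt_mul (show 0 ≤ (n : ℝ) * p.logArm K by positivity),
      Real.sqrt_mul (show 0 ≤ u by linarith), Real.sqrt_sq hm.le,
      Real.sqrt_sq (show 0 ≤ p.eta * p.logArm K by positivity)] at e4
  have e1 : ∑ s ∈ armRounds x p.prep t i, (a / p.eta * resid mu x s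
      - (a / p.eta) ^ 2 * (1 / 2 + 2 * a / 9) * sd (D (x s).2.1) ^ 2)
      = a / p.eta * S - (a / p.eta) ^ 2 * (1 / 2 + 2 * a / 9) * armVar p D x t i := by
    rw [Finset.sum_sub_distrib, ← Finset.mul_sum, ← Finset.mul_sum, ← hS]
    rfl
  rw [e1] at h1
  -- `13/18 · 20/7 = 130/63 < 2.07`; the exponent `2L` of the event raises this to `4.07`.
  have h8 : (a / p.eta) ^ 2 * (1 / 2 + 2 * a / 9) * armVar p D x t i ≤ 2.07 * p.logArm K := by
    have hV : 0 ≤ armVar p D x t i := Finset.sum_nonneg fun _ _ => sq_nonneg _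
    calc _ ≤ (a / p.eta) ^ 2 * (1 / 2 + 2 * 1 / 9) * (n * (20 / 7 * sdMin D ^ 2)) := by gcongr
      _ = (a / p.eta) ^ 2 * (1 / 2 + 2 * 1 / 9) * (20 / 7) * (n * sdMin D ^ 2) := by ring
      _ = 130 / 63 * (a ^ 2 * u) * p.logArm K := by
          rw [← h6]; field_simp; norm_num
      _ ≤ 130 / 63 * 1 * p.logArm K := by gcongr
      _ ≤ _ := by nlinarith
  rw [e2]
  have hpos : 0 < a / p.eta := by positivity
  refine le_of_mul_le_mul_left ?_ hpos
  calc a / p.eta * S ≤ 4.07 * p.logArm K := by linarith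
    _ ≤ a * (7 * Real.sqrt u) * p.logArm K := by gcongr
    _ = _ := by field_simp

theorem UCB_eq (h : Regime p mu D x i₀ i₁ k) {t : ℕ} (ht : p.start₃ x ≤ t) (i : Fin K) :
    p.UCB x t i = mu i + (∑ s ∈ armRounds x p.prep t i, resid mu x s
      + 2 * Real.sqrt (2 * p.logArm K * armVarEst p x t i)) / (armRounds x p.prep t i).card := by
  rw [Params.UCB, armMean_eq mu x p.prep t i (Finset.card_pos.1 (h.card_arm_pos ht i)), avg,
    armVarEst]
  ring

theorem le_UCB_best (h : Regime p mu D x i₀ i₁ k) {t : ℕ} (ht : p.start₃ x ≤ t)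
    (htT : t < p.T) : mu k ≤ p.UCB x t k := by
  rw [h.UCB_eq ht]
  have h1 := h.neg_sum_resid_le ht htT
  have : 0 ≤ (∑ s ∈ armRounds x p.prep t k, resid mu x s
      + 2 * Real.sqrt (2 * p.logArm K * armVarEst p x t k)) / (armRounds x p.prep t k).card :=
    div_nonneg (by linarith) (Nat.cast_nonneg _)
  linarith

theorem gap_eq (h : Regime p mu D x i₀ i₁ k) (i : Fin K) : gap mu i = mu k - mu i := by
  have : Nonempty (Fin K) := ⟨k⟩
  rw [gap]
  congr 1
  exact le_antisymm (ciSup_le h.best) (le_ciSup (Set.finite_range mu).bddAbove k)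

theorem gap_nonneg (h : Regime p mu D x i₀ i₁ k) (i : Fin K) : 0 ≤ gap mu i := by
  rw [h.gap_eq]; linarith [h.best i]

/-- An arm pulled in the adaptive phase has been pulled rarely compared with its gap. -/
theorem card_mul_gap_le (h : Regime p mu D x i₀ i₁ k) {t : ℕ} (ht : p.start₃ x ≤ t)
    (htT : t < p.T) :
    (armRounds x p.prep t (x t).1).card * gap mu (x t).1
      ≤ 18 * (Real.sqrt ((armRounds x p.prep t (x t).1).card * p.logArm K) * sdMin D) := by
  have hL := h.logArm_pos
  have hm := h.sdMin_pos
  set i := (x t).1 with hi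
  have h1 : mu k ≤ p.UCB x t i := (h.le_UCB_best ht htT).trans ((h.run.adaptive t htT ht).1 k)
  have hn : (0 : ℝ) < (armRounds x p.prep t i).card := by exact_mod_cast h.card_arm_pos ht i
  rw [h.UCB_eq ht, ← sub_le_iff_le_add', le_div_iff₀ hn, ← h.gap_eq] at h1
  have h2 := h.sum_resid_le ht htT i
  have h3 := (h.armVarEst_le ht htT i).trans (mul_le_mul_of_nonneg_left (h.armVar_le htT i)
    (by norm_num : (0 : ℝ) ≤ 5))
  set n := ((armRounds x p.prep t i).card : ℝ)
  -- `5.4² > 2 · 5 · 20/7`, and `7 + 2 · 5.4 < 18`.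
  have h4 : Real.sqrt (2 * p.logArm K * armVarEst p x t i)
      ≤ 5.4 * (Real.sqrt (n * p.logArm K) * sdMin D) := by
    refine Real.sqrt_le_iff.2 ⟨by positivity, ?_⟩
    rw [mul_pow, mul_pow, Real.sq_sqrt (by positivity)]
    have h5 : 0 ≤ n * p.logArm K * sdMin D ^ 2 := by positivity
    calc _ ≤ 2 * p.logArm K * (5 * (n * (20 / 7 * sdMin D ^ 2))) := by gcongr
      _ ≤ _ := by nlinarith
  have h6 : 0 ≤ Real.sqrt (n * p.logArm K) * sdMin D := by positivity
  linarith

end Regime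
/-! ### Regret -/

namespace Regime

variable {K M : ℕ} {p : Params M} {mu : Fin K → ℝ} {D : Fin M → Measure ℝ}
  {x : ℕ → Round K M} {i₀ i₁ k : Fin K}

/-- The pulls of arm `i` in the adaptive phase. -/
noncomputable def adaptivePulls (p : Params M) (x : ℕ → Round K M) (i : Fin K) : Finset ℕ :=
  {s ∈ Finset.Ico (p.start₃ x) p.T | (x s).1 = i}

/-- The gap bound is applied at the last adaptive pull. That pull adds one to the earlier count `n ≥
1`, so the total is at most `2n`, and `648 = 2 · 18²`. -/
theorem card_adaptivePulls_mul_le (h : Regime p mu D x i₀ i₁ k) (i : Fin K) :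
    (adaptivePulls p x i).card * gap mu i ^ 2 ≤ 648 * (p.logArm K * sdMin D ^ 2) := by
  have hL := h.logArm_pos
  rcases (adaptivePulls p x i).eq_empty_or_nonempty with he | hne
  · rw [he]; simp; positivity
  set t := (adaptivePulls p x i).max' hne with ht
  have htm := (adaptivePulls p x i).max'_mem hne
  rw [← ht, adaptivePulls, Finset.mem_filter, Finset.mem_Ico] at htm
  obtain ⟨⟨h1, h2⟩, h3⟩ := htm
  have hsub : adaptivePulls p x i ⊆ insert t (armRounds x p.prep t i) := by
    intro s hs
    have h4 := Finset.le_max' _ s hs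
    rw [adaptivePulls, Finset.mem_filter, Finset.mem_Ico] at hs
    rw [Finset.mem_insert, armRounds, Finset.mem_filter, Finset.mem_Ico]
    rcases h4.lt_or_eq with h5 | h5
    · exact Or.inr ⟨⟨(Params.prep_le_start₂.trans Params.start₂_le_start₃).trans hs.1.1, h5⟩, hs.2⟩
    · exact Or.inl h5
  have h5 := (Finset.card_le_card hsub).trans (Finset.card_insert_le _ _)
  have h6 := h.card_arm_pos h1 i
  have h7 := h.card_mul_gap_le h1 h2
  rw [h3] at h7
  set n := (armRounds x p.prep t i).card
  have h8 : ((adaptivePulls p x i).card : ℝ) ≤ 2 * n := by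
    exact_mod_cast (by omega : (adaptivePulls p x i).card ≤ 2 * n)
  have hn : (0 : ℝ) < n := by exact_mod_cast h6
  have hg := h.gap_nonneg i
  have h9 := pow_le_pow_left₀ (by positivity) h7 2
  rw [mul_pow, mul_pow, mul_pow, Real.sq_sqrt (by positivity)] at h9
  have h10 : n * gap mu i ^ 2 ≤ 324 * (p.logArm K * sdMin D ^ 2) := by
    refine le_of_mul_le_mul_left ?_ hn
    linarith
  calc _ ≤ 2 * n * gap mu i ^ 2 := by gcongr
    _ ≤ _ := by linarith

theorem sum_adaptive (p : Params M) (x : ℕ → Round K M) (f : Fin K → ℝ) :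
    ∑ s ∈ Finset.Ico (p.start₃ x) p.T, f (x s).1 = ∑ i, (adaptivePulls p x i).card * f i := by
  rw [← Finset.sum_fiberwise (Finset.Ico (p.start₃ x) p.T) (fun s => (x s).1)]
  refine Finset.sum_congr rfl fun i _ => ?_
  rw [← nsmul_eq_mul, ← Finset.sum_const]
  exact Finset.sum_congr rfl fun s hs => by rw [(Finset.mem_filter.1 hs).2]

theorem adaptive_regret_le_gapSum (h : Regime p mu D x i₀ i₁ k) {gamma : ℝ} (hg : 0 < gamma) :
    ∑ s ∈ Finset.Ico (p.start₃ x) p.T, gap mu (x s).1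
      ≤ 648 * p.logArm K * gapSum mu D gamma := by
  classical
  have hL := h.logArm_pos
  have hm := h.sdMin_nonneg
  rw [sum_adaptive, gapSum, Finset.mul_sum, Finset.sum_filter]
  refine Finset.sum_le_sum fun i _ => ?_
  split_ifs with hi
  · have h1 := h.card_adaptivePulls_mul_le i
    rw [mul_div_assoc', le_div_iff₀ hi]
    calc _ = (adaptivePulls p x i).card * gap mu i ^ 2 := by ring
      _ ≤ 648 * (p.logArm K * sdMin D ^ 2) := h1
      _ ≤ 648 * (p.logArm K * (sdMin D + gamma) ^ 2) := by gcongr; linarith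
      _ = _ := by ring
  · have : gap mu i = 0 := le_antisymm (not_lt.1 hi) (h.gap_nonneg i)
    simp [this]

/-- Cauchy–Schwarz over rounds: each arm contributes at most `648 L σ*²` to the sum of squared gaps,
so no threshold on the gaps is needed. Finally `648 ≤ 26²`. -/
theorem adaptive_regret_le_sqrt (h : Regime p mu D x i₀ i₁ k) :
    ∑ s ∈ Finset.Ico (p.start₃ x) p.T, gap mu (x s).1
      ≤ 26 * Real.sqrt (p.logArm K) * (sdMin D * Real.sqrt (K * p.T)) := by
  have hL := h.logArm_pos
  have hm := h.sdMin_nonneg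
  refine le_of_sq_le_sq ?_ (by positivity)
  have h1 : ∑ s ∈ Finset.Ico (p.start₃ x) p.T, gap mu (x s).1 ^ 2
      ≤ K * (648 * (p.logArm K * sdMin D ^ 2)) := by
    rw [sum_adaptive p x fun i => gap mu i ^ 2]
    refine (Finset.sum_le_card_nsmul _ _ _ fun i _ => h.card_adaptivePulls_mul_le i).trans ?_
    rw [Finset.card_univ, Fintype.card_fin, nsmul_eq_mul]
  have h2 : ((Finset.Ico (p.start₃ x) p.T).card : ℝ) ≤ p.T := by
    rw [Nat.card_Ico]; exact_mod_cast Nat.sub_le _ _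
  calc _ ≤ ((Finset.Ico (p.start₃ x) p.T).card : ℝ)
        * ∑ s ∈ Finset.Ico (p.start₃ x) p.T, gap mu (x s).1 ^ 2 := sq_sum_le_card_mul_sum_sq
    _ ≤ p.T * (K * (648 * (p.logArm K * sdMin D ^ 2))) := by gcongr
    _ = 648 * (p.logArm K * (sdMin D ^ 2 * (K * p.T))) := by ring
    _ ≤ 676 * (p.logArm K * (sdMin D ^ 2 * (K * p.T))) := by gcongr; norm_num
    _ = _ := by
        rw [mul_pow, mul_pow, mul_pow, Real.sq_sqrt hL.le, Real.sq_sqrt (by positivity)]; ring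

end Regime

/-! ### Cost of the rounds before the adaptive phase. -/

section Exploration

variable {K M : ℕ} {p : Params M}

theorem one_le_log_total (hK : 1 ≤ K) (hM : 1 ≤ M) (hT : 1 ≤ p.T) (hd : 0 < p.delta)
    (hd1 : p.delta < 1) : 1 ≤ Real.log (3 * K * M * p.T / p.delta) := by
  have hK' : (1 : ℝ) ≤ K := by exact_mod_cast hK
  have hM' : (1 : ℝ) ≤ M := by exact_mod_cast hM
  have hT' : (1 : ℝ) ≤ p.T := by exact_mod_cast hT
  rw [Real.le_log_iff_exp_le (by positivity), le_div_iff₀ hd]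
  calc Real.exp 1 * p.delta ≤ 3 * 1 := by
        have := Real.exp_one_lt_d9
        gcongr
        linarith
    _ = 3 * 1 * 1 * 1 := by norm_num
    _ ≤ _ := by gcongr

theorem log_div_le_log_total {K M : ℕ} {p : Params M} {y : ℝ} (hy : 0 < y) (hd : 0 < p.delta)
    (h : y ≤ 3 * K * M * p.T) :
    Real.log (y / p.delta) ≤ Real.log (3 * K * M * p.T / p.delta) :=
  Real.log_le_log (by positivity) (by gcongr)

/-- The regret incurred before the adaptive phase. -/
theorem start₃_mul_le (x : ℕ → Round K M) {muBar : ℝ} (hmu : 0 ≤ muBar) (hK : 1 ≤ K) (hM : 1 ≤ M)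
    (hT : 1 ≤ p.T) (hd : 0 < p.delta) (hd1 : p.delta < 1) (hc : 0 < p.c) (hn : 0 < p.nu)
    (hb : p.minBudget ≤ p.tau) :
    p.start₃ x * muBar
      ≤ 4000 * Real.log (3 * K * M * p.T / p.delta) * p.exploration K muBar := by
  have hK' : (1 : ℝ) ≤ K := by exact_mod_cast hK
  have hM' : (1 : ℝ) ≤ M := by exact_mod_cast hM
  have hT' : (1 : ℝ) ≤ p.T := by exact_mod_cast hT
  have hl := one_le_log_total hK hM hT hd hd1
  have hKM : (1 : ℝ) ≤ K * M := by nlinarith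
  have hKT : (1 : ℝ) ≤ K * p.T := by nlinarith
  have l1 : p.logArm K ≤ Real.log (3 * K * M * p.T / p.delta) :=
    log_div_le_log_total (by positivity) hd (by
      calc (3 : ℝ) * K * p.T = 3 * K * 1 * p.T := by ring
        _ ≤ _ := by gcongr)
  have l2 : p.logSrc ≤ Real.log (3 * K * M * p.T / p.delta) :=
    log_div_le_log_total (by positivity) hd (by
      calc (3 : ℝ) * M * p.T = 3 * 1 * M * p.T := by ring
        _ ≤ _ := by gcongr)
  have l3 : Real.log (12 * M / p.delta) ≤ 3 * Real.log (3 * K * M * p.T / p.delta) := by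
    have e : Real.log (12 * M / p.delta) = Real.log 4 + Real.log (3 * M / p.delta) := by
      rw [← Real.log_mul (by norm_num) (by positivity)]; congr 1; ring
    have e2 : Real.log (3 * M / p.delta) ≤ Real.log (3 * K * M * p.T / p.delta) :=
      log_div_le_log_total (by positivity) hd (by
        calc (3 : ℝ) * M = 3 * 1 * M * 1 := by ring
          _ ≤ _ := by gcongr)
    have e3 : Real.log 4 ≤ 2 := by
      rw [show (4 : ℝ) = 2 ^ 2 by norm_num, Real.log_pow]
      have := Real.log_two_lt_d9
      norm_num; linarith
    rw [e]; linarith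
  have p0 : 0 ≤ p.logArm K := Real.log_nonneg (by
    rw [le_div_iff₀ hd]; nlinarith)
  have p1 : 0 ≤ p.logSrc := Real.log_nonneg (by
    have : (1 : ℝ) ≤ M * p.T := by nlinarith
    rw [le_div_iff₀ hd]; nlinarith)
  set l := Real.log (3 * K * M * p.T / p.delta) with hldef
  have hα : (p.alpha K : ℝ) ≤ l * (p.eta ^ 2 / p.c ^ 2) + 1 := by
    refine (Nat.ceil_lt_add_one (by positivity)).le.trans ?_
    calc p.eta ^ 2 * p.logArm K / p.c ^ 2 + 1 = p.logArm K * (p.eta ^ 2 / p.c ^ 2) + 1 := by ring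
      _ ≤ _ := by gcongr
  have hβ : (p.beta K : ℝ) ≤ 3 * K + l * (4 * p.eta ^ 4 / p.nu + 16 * p.eta ^ 4 / p.c ^ 4) := by
    have h4 : 0 ≤ p.eta ^ 4 := by positivity
    refine (Nat.ceil_lt_add_one (by positivity)).le.trans ?_
    calc 2 * K + 4 * p.eta ^ 4 * p.logSrc / p.nu + 16 * p.eta ^ 4 * p.logSrc / p.c ^ 4 + 1
        = 2 * K + 1 + p.logSrc * (4 * p.eta ^ 4 / p.nu + 16 * p.eta ^ 4 / p.c ^ 4) := by ring
      _ ≤ 2 * K + K + l * (4 * p.eta ^ 4 / p.nu + 16 * p.eta ^ 4 / p.c ^ 4) := by gcongr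
      _ = _ := by ring
  have hS : ((p.surviving x).card : ℝ) ≤ M := by
    have := Finset.card_le_univ (p.surviving x)
    rw [Fintype.card_fin] at this
    exact_mod_cast this
  have hτ : p.minBudget ≤ 3072 * l * (p.eta ^ 4 / p.c ^ 4) := by
    rw [Params.minBudget]
    calc 1024 * p.eta ^ 4 * Real.log (12 * M / p.delta) / p.c ^ 4
        = 1024 * (p.eta ^ 4 / p.c ^ 4) * Real.log (12 * M / p.delta) := by ring
      _ ≤ 1024 * (p.eta ^ 4 / p.c ^ 4) * (3 * l) := by
          have h4 : 0 ≤ p.eta ^ 4 := by positivity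
          gcongr
      _ = _ := by ring
  set a := p.eta ^ 4 / p.c ^ 4 with ha
  set b := p.eta ^ 2 / p.c ^ 2 with hb'
  set d := p.eta ^ 4 / p.nu with hd'
  have ha0 : 0 ≤ a := by positivity
  have hb0 : 0 ≤ b := by positivity
  have hd0 : 0 ≤ d := by positivity
  have e0 : p.exploration K muBar = muBar * (2 * M * a + K * b + K * M + M * d
      + M * (p.tau - p.minBudget)) := by
    rw [Params.exploration, ha, hb', hd']; ring
  have hl0 : 0 ≤ l := by linarith
  have e1 : (p.start₃ x : ℝ) ≤ M * p.tau + K * (l * b + 1)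
      + M * (3 * K + l * (4 * d + 16 * a)) := by
    rw [Params.start₃, Params.start₂, Params.prep]
    push_cast
    have : (4 * p.eta ^ 4 / p.nu + 16 * p.eta ^ 4 / p.c ^ 4) = 4 * d + 16 * a := by
      rw [ha, hd']; ring
    rw [this] at hβ
    gcongr
  rw [e0]
  calc (p.start₃ x : ℝ) * muBar ≤ (M * p.tau + K * (l * b + 1)
      + M * (3 * K + l * (4 * d + 16 * a))) * muBar := by gcongr
    _ ≤ (4000 * l * (2 * M * a + K * b + K * M + M * d + M * (p.tau - p.minBudget))) * muBar := by
        gcongr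
        -- Only the minimal budget is converted into a logarithm; the excess is matched by the last
        -- summand of `exploration`.
        have q1 : M * p.tau ≤ l * (M * (p.tau - p.minBudget)) + M * (3072 * l * a) := by
          have : M * (p.tau - p.minBudget) ≤ l * (M * (p.tau - p.minBudget)) :=
            le_mul_of_one_le_left (mul_nonneg (by linarith) (by linarith)) hl
          have := mul_le_mul_of_nonneg_left hτ (by linarith : (0 : ℝ) ≤ M)
          linarith
        have q2 : (K : ℝ) ≤ l * (K * M) := by
          calc (K : ℝ) = 1 * (K * 1) := by ring
            _ ≤ _ := by gcongr
        have q3 : (K : ℝ) * M ≤ l * (K * M) := le_mul_of_one_le_left (by positivity) hl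
        have q4 : 0 ≤ l * (M * (p.tau - p.minBudget)) :=
          mul_nonneg hl0 (mul_nonneg (by linarith) (by linarith))
        have q5 : 0 ≤ l * (M * a) := by positivity
        have q6 : 0 ≤ l * (K * b) := by positivity
        have q7 : 0 ≤ l * (M * d) := by positivity
        linarith
    _ = _ := by ring

theorem gap_mem {mu : Fin K → ℝ} {muBar : ℝ} (h : ∀ i, mu i ∈ Set.Icc 0 muBar) (i : Fin K) :
    gap mu i ∈ Set.Icc 0 muBar := by
  have : Nonempty (Fin K) := ⟨i⟩
  have h1 : ⨆ k, mu k ≤ muBar := ciSup_le fun k => (h k).2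
  have h2 := le_ciSup (Set.finite_range mu).bddAbove i
  exact ⟨sub_nonneg.2 h2, by rw [gap]; linarith [(h i).1]⟩

theorem regret_le_start₃ {mu : Fin K → ℝ} {muBar : ℝ} (h : ∀ i, mu i ∈ Set.Icc 0 muBar)
    (x : ℕ → Round K M) :
    ∑ s ∈ Finset.range p.T, gap mu (x s).1
      ≤ p.start₃ x * muBar + ∑ s ∈ Finset.Ico (p.start₃ x) p.T, gap mu (x s).1 := by
  have hsub : Finset.range p.T ⊆ Finset.range (p.start₃ x) ∪ Finset.Ico (p.start₃ x) p.T := by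
    intro s hs
    rw [Finset.mem_range] at hs
    rw [Finset.mem_union, Finset.mem_range, Finset.mem_Ico]
    omega
  calc _ ≤ ∑ s ∈ Finset.range (p.start₃ x) ∪ Finset.Ico (p.start₃ x) p.T, gap mu (x s).1 :=
        Finset.sum_le_sum_of_subset_of_nonneg hsub fun s _ _ => (gap_mem h _).1
    _ = ∑ s ∈ Finset.range (p.start₃ x), gap mu (x s).1
        + ∑ s ∈ Finset.Ico (p.start₃ x) p.T, gap mu (x s).1 := by
        refine Finset.sum_union (Finset.disjoint_left.2 fun s h1 h2 => ?_)
        rw [Finset.mem_range] at h1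
        rw [Finset.mem_Ico] at h2
        omega
    _ ≤ _ := by
        gcongr
        refine (Finset.sum_le_card_nsmul _ _ _ fun s _ => (gap_mem h _).2).trans ?_
        rw [Finset.card_range, nsmul_eq_mul]

end Exploration

/-! ### Assembly of the regret bounds. -/

section Bounds

variable {K M : ℕ} {p : Params M} {mu : Fin K → ℝ} {D : Fin M → Measure ℝ}

theorem exploration_nonneg {muBar : ℝ} (hmu : 0 ≤ muBar) (hc : 0 < p.c) (hn : 0 < p.nu)
    (hb : p.minBudget ≤ p.tau) : 0 ≤ p.exploration K muBar := by
  have : 0 ≤ p.eta ^ 4 := by positivity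
  have := mul_nonneg (mul_nonneg (Nat.cast_nonneg (α := ℝ) M) hmu) (sub_nonneg.2 hb)
  rw [Params.exploration]
  positivity

theorem gapSum_nonneg (mu : Fin K → ℝ) (D : Fin M → Measure ℝ) (gamma : ℝ) :
    0 ≤ gapSum mu D gamma := by
  classical
  exact Finset.sum_nonneg fun i hi => div_nonneg (sq_nonneg _) (Finset.mem_filter.1 hi).2.le

theorem sdMin_nonneg (D : Fin M → Measure ℝ) : 0 ≤ sdMin D :=
  Real.iInf_nonneg fun _ => Real.sqrt_nonneg _

/-- The regret bounds, on the good event. -/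
theorem regret_le {x : ℕ → Round K M} {i₀ i₁ k : Fin K} {muBar gamma : ℝ} (hM : 1 ≤ M)
    (hT : 1 ≤ p.T) (hd : 0 < p.delta) (hd1 : p.delta < 1) (hc : 0 < p.c) (hn : 0 < p.nu)
    (hg : 0 < gamma) (ht : 1 ≤ p.tau) (hb : p.minBudget ≤ p.tau)
    (hmu : ∀ i, mu i ∈ Set.Icc 0 muBar) (hD : NoiseLaws D p.eta) (he : 0 < p.eta)
    (hr : p.IsRun x i₀ i₁) (hk : ∀ i, mu i ≤ mu k) (hgood : Good p mu D x k)
    (hex : ∃ j ∈ p.surviving x, p.c ^ 2 ≤ sd (D j) ^ 2) :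
    ∑ s ∈ Finset.range p.T, gap mu (x s).1
      ≤ 4000 * Real.log (3 * K * M * p.T / p.delta) *
        (p.exploration K muBar + p.separation x D gamma + gapSum mu D gamma) ∧
    ∑ s ∈ Finset.range p.T, gap mu (x s).1
      ≤ 4000 * Real.log (3 * K * M * p.T / p.delta) *
        (p.exploration K muBar + (sdMin D + p.c) * Real.sqrt (K * p.T)) := by
  have hK : 1 ≤ K := Nat.one_le_iff_ne_zero.2 (Fin.pos k).ne'
  have hmu0 : 0 ≤ muBar := (hmu k).1.trans (hmu k).2
  have hl := one_le_log_total hK hM hT hd hd1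
  have h1 := regret_le_start₃ (p := p) hmu x
  have h2 := start₃_mul_le x hmu0 hK hM hT hd hd1 hc hn hb
  have h3 := exploration_nonneg (K := K) hmu0 hc hn hb
  have h4 : 0 ≤ p.separation x D gamma := Real.sqrt_nonneg _
  have h5 := gapSum_nonneg mu D gamma
  have h6 := sdMin_nonneg D
  have h7 : p.logArm K ≤ Real.log (3 * K * M * p.T / p.delta) := by
    have hM' : (1 : ℝ) ≤ M := by exact_mod_cast hM
    refine log_div_le_log_total (by positivity) hd ?_
    calc (3 : ℝ) * K * p.T = 3 * K * 1 * p.T := by ring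
      _ ≤ _ := by gcongr
  set l := Real.log (3 * K * M * p.T / p.delta)
  -- If exploration exhausts the horizon, its cost alone bounds the regret and no concentration is
  -- needed.
  rcases le_or_gt p.T (p.start₃ x) with hs | hs
  · rw [Finset.Ico_eq_empty_of_le hs, Finset.sum_empty, add_zero] at h1
    constructor
    · refine (h1.trans h2).trans (mul_le_mul_of_nonneg_left ?_ (by positivity))
      linarith
    · refine (h1.trans h2).trans (mul_le_mul_of_nonneg_left ?_ (by positivity))
      exact le_add_of_nonneg_right (by positivity)
  · have hR : Regime p mu D x i₀ i₁ k :=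
      ⟨hD, he, hd, hd1, hc, hn, ht, hb, hr, hgood, hs, hex, hk⟩
    have hL := hR.logArm_pos
    constructor
    · have h8 := hR.adaptive_regret_le_gapSum hg
      have h9 : 648 * p.logArm K * gapSum mu D gamma ≤ 4000 * l * gapSum mu D gamma := by
        gcongr; norm_num
      have h10 : 0 ≤ 4000 * l * p.separation x D gamma := by positivity
      linarith
    · have h8 := hR.adaptive_regret_le_sqrt
      have h9 : Real.sqrt (p.logArm K) ≤ l :=
        Real.sqrt_le_iff.2 ⟨by linarith, by nlinarith⟩
      have h10 : 26 * Real.sqrt (p.logArm K) * (sdMin D * Real.sqrt (K * p.T))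
          ≤ 4000 * l * ((sdMin D + p.c) * Real.sqrt (K * p.T)) := by
        gcongr <;> linarith
      linarith

end Bounds

end Soar

theorem mainTheorem1 (R : ℝ) (hR : 1 ≤ R) :
    ∃ (C : ℝ) (q : ℕ), 0 < C ∧
      ∀ (K M : ℕ) (p : Soar.Params M) (muBar gamma : ℝ)
        (mu : Fin K → ℝ) (D : Fin M → Measure ℝ) (i₀ i₁ : Fin K)
        (Ω : Type*) (mΩ : MeasurableSpace Ω) (P : Measure Ω) (ℱ : Filtration ℕ mΩ)
        (arm : ℕ → Ω → Fin K) (src : ℕ → Ω → Fin M) (X : ℕ → Ω → ℝ),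
        IsProbabilityMeasure P →
        -- parameters
        1 ≤ p.T → 0 < p.delta → p.delta < 1 → 0 < p.c → 0 < p.nu → 0 < gamma →
        1 ≤ p.tau → p.minBudget ≤ p.tau →
        -- the instance
        (∀ i, mu i ∈ Set.Icc 0 muBar) → Soar.NoiseLaws D p.eta →
        (∀ j k, p.kappa j = some k → k = centralMoment id 4 (D j)) →
        -- `c*` is of the order of the standard deviations of the sources
        (∀ j, p.c ≤ R * Soar.sd (D j)) →
        -- the interaction, with SOAR as the learner
        Soar.Interaction P ℱ mu D arm src X →
        (∀ ω, p.IsRun (fun t => (arm t ω, src t ω, X t ω)) i₀ i₁) →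
        ENNReal.ofReal (1 - p.delta) ≤
          P {ω |
            (∃ j ∈ p.surviving (fun t => (arm t ω, src t ω, X t ω)),
              p.c ^ 2 ≤ Soar.sd (D j) ^ 2) →
            Soar.regret mu arm p.T ω ≤
                C * Real.log (3 * K * M * p.T / p.delta) ^ q *
                  (p.exploration K muBar
                    + p.separation (fun t => (arm t ω, src t ω, X t ω)) D gamma
                    + Soar.gapSum mu D gamma) ∧
            Soar.regret mu arm p.T ω ≤
                C * Real.log (3 * K * M * p.T / p.delta) ^ q *
                  (p.exploration K muBar
                    + (Soar.sdMin D + p.c) * Real.sqrt (K * p.T))} := by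
  -- One logarithm suffices, and the constants can be chosen independently of `R`.
  refine ⟨4000, 1, by norm_num, ?_⟩
  intro K M p muBar gamma mu D i₀ i₁ Ω mΩ P ℱ arm src X hP hT hd hd1 hc hn hg ht hb hmu hD _ hcR
    hI hrun
  have hΩ : Nonempty Ω := nonempty_of_isProbabilityMeasure P
  obtain ⟨ω₀⟩ := hΩ
  have hM : 1 ≤ M := Nat.one_le_iff_ne_zero.2 (Fin.pos (src 0 ω₀)).ne'
  -- The order condition on `c` makes some standard deviation positive, which excludes `η = 0`.
  have he : 0 < p.eta :=
    (pos_of_mul_pos_right (hc.trans_le (hcR (src 0 ω₀))) (by linarith)).trans_le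
      (hD.law (src 0 ω₀)).sd_le
  have : Nonempty (Fin K) := ⟨i₀⟩
  obtain ⟨k, hk⟩ := Finite.exists_max mu
  have hbad := hI.measure_not_good_le hD he hT hd hd1 hM k
  rw [ENNReal.ofReal_sub 1 hd.le, ENNReal.ofReal_one, tsub_le_iff_right]
  set A : Set Ω := _
  change 1 ≤ P A + ENNReal.ofReal p.delta
  have hA : A ∪ {ω | ¬ Soar.Good p mu D (Soar.traj arm src X ω) k} = Set.univ := by
    refine Set.eq_univ_of_forall fun ω => ?_
    by_cases hω : Soar.Good p mu D (Soar.traj arm src X ω) k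
    · refine Or.inl fun hex => ?_
      rw [pow_one]
      exact Soar.regret_le hM hT hd hd1 hc hn hg ht hb hmu hD he (hrun ω) hk hω hex
    · exact Or.inr hω
  calc (1 : ENNReal) = P Set.univ := measure_univ.symm
    _ ≤ P A + P {ω | ¬ Soar.Good p mu D (Soar.traj arm src X ω) k} := by
        rw [← hA]; exact measure_union_le _ _
    _ ≤ _ := by gcongr
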